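/- Let $\Bbbk$ be a field. A symmetric operad $\mathcal P$ over $\Bbbk$ consists of right $\Bbbk\mathbb S_n$-modules $\mathcal P(n)$ ($n\ge 0$, action written $*$), an identity $\mathbf 1\in\mathcal P(1)$ and partial compositions $\circ_i:\mathcal P(m)\otimes\mathcal P(n)\to\mathcal P(m+n-1)$ ($1\le i\le m$) satisfying the usual unit, associativity and equivariance axioms. A *derivation* of $\mathcal P$ is a family of $\Bbbk$-linear, $\mathbb S_n$-equivariant maps $\partial:\mathcal P(n)\to\mathcal P(n)$ with $\partial(\mu\circ_i\nu)=\partial(\mu)\circ_i\nu+\mu\circ_i\partial(\nu)$ for all $\mu,\nu,i$. The derivations form a Lie algebra $\mathrm{Der}(\mathcal P)$ under the commutator. A derivation is *inner* if there is $\lambda\in\mathcal P(1)$ such that it equals $\theta\mapsto\lambda\circ_1\theta-\sum_{i=1}^n\theta\circ_i\lambda$ for all $n$ and all $\theta\in\mathcal P(n)$. Let $\mathrm{IDer}(\mathcal P)\subseteq\mathrm{Der}(\mathcal P)$ be the subspace of inner derivations and $H^1(\mathcal P)=\mathrm{Der}(\mathcal P)/\mathrm{IDer}(\mathcal P)$.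 Let $\mathcal{A}s$ be the operad of unital associative algebras ($\mathcal{A}s(n)=\Bbbk\mathbb S_n$ for $n\ge 0$), $\mathcal{C}om$ the operad of unital commutative algebras ($\mathcal{C}om(n)=\Bbbk$ for $n\ge 0$), $\mathcal{L}ie$ the operad generated by $b\in\mathcal{L}ie(2)$ subject to $b*(12)=-b$ and $b\circ_2 b=b\circ_1 b+(b\circ_2 b)*(12)$, and $\mathcal{P}ois$ the operad of unital commutative Poisson algebras, generated by $1_0\in\mathcal{P}ois(0)$ and $1_2,b\in\mathcal{P}ois(2)$ subject to $1_2\circ_1 1_0=\mathbf 1=1_2\circ_2 1_0$, $b\circ_1 1_0=0=b\circ_2 1_0$, $1_2*(12)=1_2$, $b*(12)=-b$, $1_2\circ_1 1_2=1_2\circ_2 1_2$, $b\circ_1 1_2=1_2\circ_2 b+(1_2\circ_2 b)*(12)$ and $b\circ_2 b=b\circ_1 b+(b\circ_2 b)*(12)$. Then: 1. $\mathrm{Der}(\mathcal{A}s)\cong\Bbbk$ and $H^1(\mathcal{A}s)=0$. 2. $\mathrm{Der}(\mathcal{C}om)\cong\Bbbk$ and $H^1(\mathcal{C}om)=0$.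 3. $\mathrm{Der}(\mathcal{L}ie)\cong\Bbbk$ and $H^1(\mathcal{L}ie)=0$. 4. If $\mathrm{char}\,\Bbbk\ne 2$, then $\mathrm{Der}(\mathcal{P}ois)\cong\Bbbk\oplus\Bbbk$ is the $2$-dimensional abelian Lie algebra, and $H^1(\mathcal{P}ois)\cong\Bbbk$. -/

import Mathlib

open Equiv (Perm)

universe u v

/-! ### Partial composition of permutations

Inputs and slots are numbered from `0`.  A permutation `φ` of `Fin m` stands for the multilinear
word in `x₀, …, x_{m-1}` in which the letter `x_j` sits at place `φ j`.  The partial composition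
`φ ∘ᵢ ψ` inserts the word of `ψ` for the letter `x_i` of the word of `φ` and renumbers.
Arities are tied together by an equation `m + n = r + 1` (that is, `r = m + n - 1`). -/

section PermComp

variable {m n r : ℕ}

/-- The new position of the old position `j ≠ i`, when position `i` is replaced by `n` ones. -/
def outPos (i : Fin m) (h : m + n = r + 1) (j : Fin m) (hj : j ≠ i) : Fin r :=
  ⟨if (j : ℕ) < i then j else j + n - 1, by
    have := Fin.val_ne_of_ne hj
    split_ifs <;> omega⟩

/-- The `t`-th of the `n` positions by which position `i` is replaced. -/
def inPos (i : Fin m) (h : m + n = r + 1) (t : Fin n) : Fin r :=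
  ⟨i + t, by omega⟩

/-- Every position after insertion is either an old one or one of the `n` inserted ones. -/
def posEquiv (i : Fin m) (h : m + n = r + 1) : {j : Fin m // j ≠ i} ⊕ Fin n ≃ Fin r where
  toFun := Sum.elim (fun j => outPos i h j.1 j.2) (inPos i h)
  invFun k :=
    if h₁ : (k : ℕ) < i then
      Sum.inl ⟨⟨k, by omega⟩, Fin.ne_of_val_ne (by simpa using h₁.ne)⟩
    else if h₂ : (k : ℕ) < i + n then
      Sum.inr ⟨k - i, by omega⟩
    else
      Sum.inl ⟨⟨k + 1 - n, by omega⟩, Fin.ne_of_val_ne (by simp only; omega)⟩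
  left_inv x := by
    rcases x with ⟨j, hj⟩ | t
    · have := Fin.val_ne_of_ne hj
      simp only [Sum.elim_inl, outPos]
      by_cases hlt : (j : ℕ) < i
      · simp [hlt]
      · have h₁ : ¬ ((j : ℕ) + n - 1 < i) := by omega
        have h₂ : ¬ ((j : ℕ) + n - 1 < i + n) := by omega
        simp only [hlt, if_false, h₁, h₂, dif_neg, not_false_iff]
        congr 2
        apply Fin.ext
        simp only
        omega
    · have h₁ : ¬ ((i : ℕ) + t < i) := by omega
      have h₂ : ((i : ℕ) + t < i + n) := by omega
      simp [inPos]
  right_inv k := by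
    apply Fin.ext
    by_cases h₁ : (k : ℕ) < i
    · simp only [h₁, dif_pos, Sum.elim_inl, outPos, if_true]
    · by_cases h₂ : (k : ℕ) < i + n
      · simp only [h₁, h₂, dif_neg, dif_pos, not_false_iff, Sum.elim_inr, inPos]
        omega
      · simp only [h₁, h₂, dif_neg, not_false_iff, Sum.elim_inl, outPos]
        split_ifs <;> omega

/-- The partial composition `φ ∘ᵢ ψ` of permutations. -/
def permComp (i : Fin m) (h : m + n = r + 1) (φ : Perm (Fin m)) (ψ : Perm (Fin n)) :
    Perm (Fin r) :=
  (posEquiv i h).symm.trans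
    ((Equiv.sumCongr (φ.subtypeEquiv fun _ => by simp) ψ).trans (posEquiv (φ i) h))

theorem permComp_outPos (i : Fin m) (h : m + n = r + 1) (φ : Perm (Fin m)) (ψ : Perm (Fin n))
    (j : Fin m) (hj : j ≠ i) :
    permComp i h φ ψ (outPos i h j hj) = outPos (φ i) h (φ j) (by simpa using hj) := by
  have : outPos i h j hj = posEquiv i h (Sum.inl ⟨j, hj⟩) := rfl
  rw [this]
  simp only [permComp, Equiv.trans_apply, Equiv.symm_apply_apply]
  rfl

theorem permComp_inPos (i : Fin m) (h : m + n = r + 1) (φ : Perm (Fin m)) (ψ : Perm (Fin n))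
    (t : Fin n) :
    permComp i h φ ψ (inPos i h t) = inPos (φ i) h (ψ t) := by
  have : inPos i h t = posEquiv i h (Sum.inr t) := rfl
  rw [this]
  simp only [permComp, Equiv.trans_apply, Equiv.symm_apply_apply]
  rfl

theorem pos_cases (i : Fin m) (h : m + n = r + 1) (k : Fin r) :
    (∃ j, ∃ hj : j ≠ i, k = outPos i h j hj) ∨ ∃ t, k = inPos i h t := by
  obtain ⟨x, rfl⟩ := (posEquiv i h).surjective k
  rcases x with ⟨j, hj⟩ | t
  · exact Or.inl ⟨j, hj, rfl⟩
  · exact Or.inr ⟨t, rfl⟩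

theorem outPos_eq {i i' : Fin m} {h : m + n = r + 1} {j j' : Fin m} {hj : j ≠ i} {hj' : j' ≠ i'}
    (hi : i = i') (hjj : j = j') : outPos i h j hj = outPos i' h j' hj' := by
  subst hi hjj; rfl

end PermComp

/-! ### Symmetric operads, partial definition -/

/-- A symmetric operad over `k`: right `k[Sₙ]`-modules `Op n` (the right action of `σ` on `x`
being `act σ x`), an identity, and partial compositions `comp i h μ ν = μ ∘ᵢ ν`, which are
defined for `μ ∈ Op m`, `ν ∈ Op n`, `i < m` and take values in `Op r` where `r = m + n - 1`. -/
structure Operad (k : Type u) [CommRing k] where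
  Op : ℕ → Type v
  [addCommGroup : ∀ n, AddCommGroup (Op n)]
  [module : ∀ n, Module k (Op n)]
  act : ∀ {n : ℕ}, Perm (Fin n) → Op n →ₗ[k] Op n
  act_one : ∀ {n : ℕ} (x : Op n), act 1 x = x
  act_mul : ∀ {n : ℕ} (σ τ : Perm (Fin n)) (x : Op n), act (σ * τ) x = act τ (act σ x)
  one : Op 1
  comp : ∀ {m n r : ℕ} (_ : Fin m) (_ : m + n = r + 1), Op m →ₗ[k] Op n →ₗ[k] Op r
  comp_one : ∀ {n : ℕ} (i : Fin n) (θ : Op n), comp i rfl θ one = θ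
  one_comp : ∀ {n : ℕ} (θ : Op n), comp (0 : Fin 1) (Nat.add_comm 1 n) one θ = θ
  /-- sequential associativity `(x ∘ᵢ y) ∘ᵢ₊ⱼ z = x ∘ᵢ (y ∘ⱼ z)` -/
  comp_assoc_seq : ∀ {l m n a b r : ℕ} (i : Fin l) (j : Fin m) (h₁ : l + m = a + 1)
    (h₂ : a + n = r + 1) (h₃ : m + n = b + 1) (h₄ : l + b = r + 1)
    (x : Op l) (y : Op m) (z : Op n),
    comp (inPos i h₁ j) h₂ (comp i h₁ x y) z = comp i h₄ x (comp j h₃ y z)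
  /-- parallel associativity `(x ∘ᵢ y) ∘_{p+m-1} z = (x ∘ₚ z) ∘ᵢ y` for `i < p` -/
  comp_assoc_par : ∀ {l m n a b r : ℕ} (i p : Fin l) (hip : i < p) (h₁ : l + m = a + 1)
    (h₂ : a + n = r + 1) (h₃ : l + n = b + 1) (h₄ : b + m = r + 1)
    (x : Op l) (y : Op m) (z : Op n),
    comp ⟨p + m - 1, by omega⟩ h₂ (comp i h₁ x y) z =
      comp ⟨i, by omega⟩ h₄ (comp p h₃ x z) y
  comp_act : ∀ {m n r : ℕ} (i : Fin m) (h : m + n = r + 1) (σ : Perm (Fin n))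
    (x : Op m) (y : Op n),
    comp i h x (act σ y) = act (permComp i h 1 σ) (comp i h x y)
  act_comp : ∀ {m n r : ℕ} (i : Fin m) (h : m + n = r + 1) (φ : Perm (Fin m))
    (x : Op m) (y : Op n),
    comp i h (act φ x) y = act (permComp i h φ 1) (comp (φ i) h x y)

attribute [instance] Operad.addCommGroup Operad.module

namespace Operad

variable {k : Type u} [CommRing k]

/-! ### Derivations and the first cohomology group -/

/-- Degree-preserving `k`-linear self-maps of an operad. -/
abbrev GradedEnd (P : Operad.{u, v} k) : Type v := ∀ n, Module.End k (P.Op n)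

/-- The commutator bracket. -/
instance (P : Operad.{u, v} k) : LieRing P.GradedEnd := LieRing.ofAssociativeRing

instance (P : Operad.{u, v} k) : LieAlgebra k P.GradedEnd := LieAlgebra.ofAssociativeAlgebra

theorem gradedEnd_lie_apply (P : Operad.{u, v} k) (D E : P.GradedEnd) {n : ℕ} (x : P.Op n) :
    ⁅D, E⁆ n x = D n (E n x) - E n (D n x) := rfl

/-- `Der(P)`: the Lie algebra of derivations of `P`, with the commutator bracket. -/
def Der (P : Operad.{u, v} k) : LieSubalgebra k P.GradedEnd where
  carrier := {D |
    (∀ (n : ℕ) (σ : Perm (Fin n)) (x : P.Op n), D n (P.act σ x) = P.act σ (D n x)) ∧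
    ∀ (m n r : ℕ) (i : Fin m) (h : m + n = r + 1) (x : P.Op m) (y : P.Op n),
      D r (P.comp i h x y) = P.comp i h (D m x) y + P.comp i h x (D n y)}
  zero_mem' := by
    constructor <;> intros <;> simp
  add_mem' := by
    rintro D E ⟨hD, hD'⟩ ⟨hE, hE'⟩
    refine ⟨fun n σ x => ?_, fun m n r i h x y => ?_⟩
    · simp [hD, hE]
    · simp only [Pi.add_apply, LinearMap.add_apply, hD', hE', map_add]
      abel
  smul_mem' := by
    rintro c D ⟨hD, hD'⟩
    refine ⟨fun n σ x => ?_, fun m n r i h x y => ?_⟩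
    · simp [hD]
    · simp [hD']
  lie_mem' := by
    rintro D E ⟨hD, hD'⟩ ⟨hE, hE'⟩
    refine ⟨fun n σ x => ?_, fun m n r i h x y => ?_⟩
    · simp only [gradedEnd_lie_apply, hD, hE, map_sub]
    · simp only [gradedEnd_lie_apply, hD', hE', map_add, map_sub, LinearMap.sub_apply]
      abel

/-- The inner derivations of `P`: those derivations of the form
`θ ↦ l ∘ θ - ∑ᵢ θ ∘ᵢ l` for some `l ∈ P(1)`. -/
def IDer (P : Operad.{u, v} k) : Submodule k P.Der where
  carrier := {D | ∃ l : P.Op 1, ∀ (n : ℕ) (θ : P.Op n),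
    D.1 n θ = P.comp (0 : Fin 1) (Nat.add_comm 1 n) l θ - ∑ i : Fin n, P.comp i rfl θ l}
  zero_mem' := ⟨0, fun n θ => by simp⟩
  add_mem' := by
    rintro D E ⟨l, hl⟩ ⟨l', hl'⟩
    refine ⟨l + l', fun n θ => ?_⟩
    have : (D + E).1 n θ = D.1 n θ + E.1 n θ := rfl
    rw [this, hl, hl']
    simp only [map_add, LinearMap.add_apply, Finset.sum_add_distrib]
    abel
  smul_mem' := by
    rintro c D ⟨l, hl⟩
    refine ⟨c • l, fun n θ => ?_⟩
    have : (c • D).1 n θ = c • D.1 n θ := rfl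
    rw [this, hl]
    simp only [map_smul, LinearMap.smul_apply, smul_sub, Finset.smul_sum]

/-- The first cohomology group `H¹(P) = Der(P) / IDer(P)`. -/
abbrev H1 (P : Operad.{u, v} k) : Type v := P.Der ⧸ P.IDer

end Operad

/-! ### The operads of unital associative and of unital commutative algebras -/

section AsCom

variable (k : Type u) [CommRing k]

/-- The bilinear extension of the partial composition of permutations to `k[Sₘ] × k[Sₙ]`. -/
noncomputable def asComp {m n r : ℕ} (i : Fin m) (h : m + n = r + 1) :
    (Perm (Fin m) →₀ k) →ₗ[k] (Perm (Fin n) →₀ k) →ₗ[k] (Perm (Fin r) →₀ k) :=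
  Finsupp.linearCombination k fun φ => Finsupp.lmapDomain k k (permComp i h φ)

variable {k}

theorem asComp_single {m n r : ℕ} (i : Fin m) (h : m + n = r + 1) (φ : Perm (Fin m))
    (ψ : Perm (Fin n)) (c d : k) :
    asComp k i h (Finsupp.single φ c) (Finsupp.single ψ d) =
      Finsupp.single (permComp i h φ ψ) (c * d) := by
  simp [asComp]

theorem permComp_comp_one {n : ℕ} (i : Fin n) (φ : Perm (Fin n)) (τ : Perm (Fin 1)) :
    permComp i rfl φ τ = φ := by
  ext x
  rcases pos_cases i (rfl : n + 1 = n + 1) x with ⟨j, hj, rfl⟩ | ⟨t, rfl⟩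
  · rw [permComp_outPos]
    have : outPos i rfl j hj = j := by
      apply Fin.ext; simp [outPos]
    rw [this]
    simp [outPos]
  · rw [permComp_inPos]
    have : inPos i rfl t = i := by
      apply Fin.ext; simp [inPos]
    rw [this]
    simp [inPos]

theorem permComp_one_comp {n : ℕ} (φ : Perm (Fin n)) (τ : Perm (Fin 1)) :
    permComp (0 : Fin 1) (Nat.add_comm 1 n) τ φ = φ := by
  ext x
  rcases pos_cases (0 : Fin 1) (Nat.add_comm 1 n) x with ⟨j, hj, rfl⟩ | ⟨t, rfl⟩
  · exact absurd (Subsingleton.elim j 0) hj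
  · rw [permComp_inPos]
    have : inPos (0 : Fin 1) (Nat.add_comm 1 n) t = t := by
      apply Fin.ext; simp [inPos]
    rw [this]
    simp [inPos]

theorem outPos_ne_inPos {m n r : ℕ} {i : Fin m} {h : m + n = r + 1} {j : Fin m} {hj : j ≠ i}
    {t : Fin n} : outPos i h j hj ≠ inPos i h t := by
  intro H
  have := Fin.val_ne_of_ne hj
  have H' := congrArg Fin.val H
  simp only [outPos, inPos] at H'
  split_ifs at H' <;> omega

theorem inPos_ne_inPos {m n r : ℕ} {i : Fin m} {h : m + n = r + 1} {s t : Fin n} (hst : s ≠ t) :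
    inPos i h s ≠ inPos i h t := by
  intro H
  have := Fin.val_ne_of_ne hst
  have H' := congrArg Fin.val H
  simp only [inPos] at H'
  omega

theorem outPos_ne_outPos {m n r : ℕ} {i : Fin m} {h : m + n = r + 1} {p q : Fin m} {hp : p ≠ i}
    {hq : q ≠ i} (hpq : p ≠ q) : outPos i h p hp ≠ outPos i h q hq := by
  intro H
  have h₁ := Fin.val_ne_of_ne hp
  have h₂ := Fin.val_ne_of_ne hq
  have h₃ := Fin.val_ne_of_ne hpq
  have H' := congrArg Fin.val H
  simp only [outPos] at H'
  split_ifs at H' <;> omega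

section Seq

variable {l m n a b r : ℕ} (i : Fin l) (j : Fin m) (h₁ : l + m = a + 1)
    (h₂ : a + n = r + 1) (h₃ : m + n = b + 1) (h₄ : l + b = r + 1)

theorem seq_out (p : Fin l) (hp : p ≠ i) :
    outPos i h₄ p hp = outPos (inPos i h₁ j) h₂ (outPos i h₁ p hp) outPos_ne_inPos := by
  have := Fin.val_ne_of_ne hp
  apply Fin.ext
  simp only [outPos, inPos]
  split_ifs <;> omega

theorem seq_in_out (q : Fin m) (hq : q ≠ j) :
    inPos i h₄ (outPos j h₃ q hq) =
      outPos (inPos i h₁ j) h₂ (inPos i h₁ q) (inPos_ne_inPos hq) := by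
  have := Fin.val_ne_of_ne hq
  apply Fin.ext
  simp only [outPos, inPos, Nat.add_lt_add_iff_left]
  by_cases hlt : (q : ℕ) < j
  · simp [hlt]
  · simp only [hlt, if_false]
    omega

theorem seq_in_in (t : Fin n) :
    inPos i h₄ (inPos j h₃ t) = inPos (inPos i h₁ j) h₂ t := by
  apply Fin.ext
  simp only [inPos]
  omega

theorem permComp_assoc_seq (φ : Perm (Fin l)) (ψ : Perm (Fin m)) (χ : Perm (Fin n)) :
    permComp (inPos i h₁ j) h₂ (permComp i h₁ φ ψ) χ =
      permComp i h₄ φ (permComp j h₃ ψ χ) := by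
  apply Equiv.ext
  intro x
  rcases pos_cases i h₄ x with ⟨p, hp, rfl⟩ | ⟨t, rfl⟩
  · rw [permComp_outPos, seq_out i j h₁ h₂ h₄ p hp, permComp_outPos,
      seq_out (φ i) (ψ j) h₁ h₂ h₄]
    exact outPos_eq (permComp_inPos ..) (permComp_outPos ..)
  · rcases pos_cases j h₃ t with ⟨q, hq, rfl⟩ | ⟨t, rfl⟩
    · rw [permComp_inPos, permComp_outPos, seq_in_out i j h₁ h₂ h₃ h₄ q hq, permComp_outPos,
        seq_in_out (φ i) (ψ j) h₁ h₂ h₃ h₄]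
      exact outPos_eq (permComp_inPos ..) (permComp_inPos ..)
    · rw [permComp_inPos, permComp_inPos, seq_in_in i j h₁ h₂ h₃ h₄ t, permComp_inPos,
        seq_in_in (φ i) (ψ j) h₁ h₂ h₃ h₄, permComp_inPos]

end Seq

section Par

variable {l m n a b r : ℕ} (i p : Fin l) (hip : i ≠ p) (h₁ : l + m = a + 1)
    (h₂ : a + n = r + 1) (h₃ : l + n = b + 1) (h₄ : b + m = r + 1)

theorem par_out (q : Fin l) (hi : q ≠ i) (hp : q ≠ p) :
    outPos (outPos i h₁ p hip.symm) h₂ (outPos i h₁ q hi) (outPos_ne_outPos hp) =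
      outPos (outPos p h₃ i hip) h₄ (outPos p h₃ q hp) (outPos_ne_outPos hi) := by
  have := Fin.val_ne_of_ne hip
  have := Fin.val_ne_of_ne hi
  have := Fin.val_ne_of_ne hp
  apply Fin.ext
  simp only [outPos]
  split_ifs <;> omega

theorem par_in_left (t : Fin m) :
    outPos (outPos i h₁ p hip.symm) h₂ (inPos i h₁ t) outPos_ne_inPos.symm =
      inPos (outPos p h₃ i hip) h₄ t := by
  have := Fin.val_ne_of_ne hip
  apply Fin.ext
  simp only [outPos, inPos]
  split_ifs <;> omega

theorem par_in_right (s : Fin n) :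
    inPos (outPos i h₁ p hip.symm) h₂ s =
      outPos (outPos p h₃ i hip) h₄ (inPos p h₃ s) outPos_ne_inPos.symm := by
  have := Fin.val_ne_of_ne hip
  apply Fin.ext
  simp only [outPos, inPos]
  split_ifs <;> omega

theorem permComp_assoc_par (φ : Perm (Fin l)) (ψ : Perm (Fin m)) (χ : Perm (Fin n)) :
    permComp (outPos i h₁ p hip.symm) h₂ (permComp i h₁ φ ψ) χ =
      permComp (outPos p h₃ i hip) h₄ (permComp p h₃ φ χ) ψ := by
  have hφ : φ i ≠ φ p := fun H => hip (φ.injective H)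
  apply Equiv.ext
  intro x
  rcases pos_cases (outPos i h₁ p hip.symm) h₂ x with ⟨y, hy, rfl⟩ | ⟨s, rfl⟩
  · rcases pos_cases i h₁ y with ⟨q, hq, rfl⟩ | ⟨t, rfl⟩
    · have hqp : q ≠ p := by rintro rfl; exact hy rfl
      refine (permComp_outPos ..).trans ?_
      rw [par_out i p hip h₁ h₂ h₃ h₄ q hq hqp]
      refine Eq.trans ?_ (permComp_outPos ..).symm
      exact (outPos_eq (permComp_outPos ..) (permComp_outPos ..)).trans
        ((par_out (φ i) (φ p) hφ h₁ h₂ h₃ h₄ (φ q) (by simpa using hq) (by simpa using hqp)).trans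
          (outPos_eq (permComp_outPos ..).symm (permComp_outPos ..).symm))
    · refine (permComp_outPos ..).trans ?_
      refine (outPos_eq (permComp_outPos ..) (permComp_inPos ..)).trans
        ((par_in_left (φ i) (φ p) hφ h₁ h₂ h₃ h₄ (ψ t)).trans ?_)
      rw [par_in_left i p hip h₁ h₂ h₃ h₄ t, permComp_inPos, permComp_outPos]
  · rw [permComp_inPos, par_in_right i p hip h₁ h₂ h₃ h₄ s, permComp_outPos, permComp_outPos,
      par_in_right (φ i) (φ p) hφ h₁ h₂ h₃ h₄]
    exact outPos_eq (permComp_outPos ..).symm (permComp_inPos ..).symm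

end Par

section Equivariance

variable {m n r : ℕ} (i : Fin m) (h : m + n = r + 1)

theorem permComp_mul_right (φ : Perm (Fin m)) (ψ σ : Perm (Fin n)) :
    permComp i h φ (ψ * σ) = permComp i h φ ψ * permComp i h 1 σ := by
  apply Equiv.ext
  intro x
  rcases pos_cases i h x with ⟨q, hq, rfl⟩ | ⟨t, rfl⟩
  · rw [Equiv.Perm.mul_apply, permComp_outPos, permComp_outPos]
    exact (permComp_outPos i h φ ψ q hq).symm
  · rw [Equiv.Perm.mul_apply, permComp_inPos, permComp_inPos]
    exact (permComp_inPos i h φ ψ (σ t)).symm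

theorem permComp_mul_left (φ τ : Perm (Fin m)) (ψ : Perm (Fin n)) :
    permComp i h (φ * τ) ψ = permComp (τ i) h φ ψ * permComp i h τ 1 := by
  apply Equiv.ext
  intro x
  rcases pos_cases i h x with ⟨q, hq, rfl⟩ | ⟨t, rfl⟩
  · rw [Equiv.Perm.mul_apply, permComp_outPos, permComp_outPos, permComp_outPos]
    rfl
  · rw [Equiv.Perm.mul_apply, permComp_inPos, permComp_inPos, permComp_inPos]
    rfl

end Equivariance

variable (k)

/-- The operad `As` of unital associative algebras: `As(n) = k[Sₙ]` for all `n ≥ 0`, with right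
multiplication as action and the bilinear extension of `permComp` as partial composition. -/
noncomputable def As : Operad.{u, u} k where
  Op n := Perm (Fin n) →₀ k
  act σ := Finsupp.lmapDomain k k (· * σ)
  act_one x := by
    induction x using Finsupp.induction_linear with
    | zero => simp
    | add f g hf hg => rw [map_add, hf, hg]
    | single φ c => simp
  act_mul σ τ x := by
    induction x using Finsupp.induction_linear with
    | zero => simp
    | add f g hf hg => simp only [map_add, hf, hg]
    | single φ c => simp [mul_assoc]
  one := Finsupp.single 1 1
  comp i h := asComp k i h
  comp_one i θ := by
    induction θ using Finsupp.induction_linear with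
    | zero => simp
    | add f g hf hg => rw [map_add, LinearMap.add_apply, hf, hg]
    | single φ c => rw [asComp_single, permComp_comp_one, mul_one]
  one_comp θ := by
    induction θ using Finsupp.induction_linear with
    | zero => simp
    | add f g hf hg => rw [map_add, hf, hg]
    | single φ c => rw [asComp_single, permComp_one_comp, one_mul]
  comp_assoc_seq i j h₁ h₂ h₃ h₄ x y z := by
    induction x using Finsupp.induction_linear with
    | zero => simp
    | add f g hf hg => simp only [map_add, LinearMap.add_apply, hf, hg]
    | single φ c =>
      induction y using Finsupp.induction_linear with
      | zero => simp
      | add f g hf hg => simp only [map_add, LinearMap.add_apply, hf, hg]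
      | single ψ d =>
        induction z using Finsupp.induction_linear with
        | zero => simp
        | add f g hf hg => simp only [map_add, hf, hg]
        | single χ e =>
          simp only [asComp_single, permComp_assoc_seq i j h₁ h₂ h₃ h₄, mul_assoc]
  comp_assoc_par {l m n a b r} i p hip h₁ h₂ h₃ h₄ x y z := by
    have e₁ : (⟨p + m - 1, by omega⟩ : Fin a) = outPos i h₁ p hip.ne' := by
      apply Fin.ext
      have : ¬ (p : ℕ) < i := by omega
      simp [outPos, this]
    have e₂ : (⟨i, by omega⟩ : Fin b) = outPos p h₃ i hip.ne := by
      apply Fin.ext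
      have : (i : ℕ) < p := by omega
      simp [outPos, this]
    rw [e₁, e₂]
    induction x using Finsupp.induction_linear with
    | zero => simp
    | add f g hf hg => simp only [map_add, LinearMap.add_apply, hf, hg]
    | single φ c =>
      induction y using Finsupp.induction_linear with
      | zero => simp
      | add f g hf hg => simp only [map_add, LinearMap.add_apply, hf, hg]
      | single ψ d =>
        induction z using Finsupp.induction_linear with
        | zero => simp
        | add f g hf hg => simp only [map_add, LinearMap.add_apply, hf, hg]
        | single χ e =>
          simp only [asComp_single, permComp_assoc_par i p hip.ne h₁ h₂ h₃ h₄]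
          rw [mul_right_comm]
  comp_act i h σ x y := by
    induction x using Finsupp.induction_linear with
    | zero => simp
    | add f g hf hg => simp only [map_add, LinearMap.add_apply, hf, hg]
    | single φ c =>
      induction y using Finsupp.induction_linear with
      | zero => simp
      | add f g hf hg => simp only [map_add, hf, hg]
      | single ψ d =>
        simp only [Finsupp.lmapDomain_apply, Finsupp.mapDomain_single, asComp_single,
          permComp_mul_right i h φ ψ σ]
  act_comp i h τ x y := by
    induction x using Finsupp.induction_linear with
    | zero => simp
    | add f g hf hg => simp only [map_add, LinearMap.add_apply, hf, hg]
    | single φ c =>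
      induction y using Finsupp.induction_linear with
      | zero => simp
      | add f g hf hg => simp only [map_add, hf, hg]
      | single ψ d =>
        simp only [Finsupp.lmapDomain_apply, Finsupp.mapDomain_single, asComp_single,
          permComp_mul_left i h φ τ ψ]

/-- The operad `Com` of unital commutative algebras: `Com(n) = k` with trivial action for all
`n ≥ 0`, all partial compositions being the multiplication of `k`. -/
def Com : Operad.{u, u} k where
  Op _ := k
  act _ := LinearMap.id
  act_one _ := rfl
  act_mul _ _ _ := rfl
  one := 1
  comp _ _ := LinearMap.mul k k
  comp_one _ _ := by simp
  one_comp _ := by simp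
  comp_assoc_seq _ _ _ _ _ _ _ _ _ := by simp [mul_assoc]
  comp_assoc_par _ _ _ _ _ _ _ _ _ _ := by simp [mul_right_comm]
  comp_act _ _ _ _ _ := rfl
  act_comp _ _ _ _ _ := rfl

end AsCom

/-! ### Operads given by generators and relations -/

/-- Formal operadic expressions in generators `G n` of arity `n`. -/
inductive OpExpr (k : Type u) (G : ℕ → Type) : ℕ → Type u
  | gen {n : ℕ} (g : G n) : OpExpr k G n
  | one : OpExpr k G 1
  | zero {n : ℕ} : OpExpr k G n
  | add {n : ℕ} (x y : OpExpr k G n) : OpExpr k G n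
  | smul {n : ℕ} (c : k) (x : OpExpr k G n) : OpExpr k G n
  | act {n : ℕ} (σ : Perm (Fin n)) (x : OpExpr k G n) : OpExpr k G n
  | comp {m n r : ℕ} (i : Fin m) (h : m + n = r + 1) (x : OpExpr k G m) (y : OpExpr k G n) :
      OpExpr k G r

namespace OpExpr

/-- The congruence on operadic expressions generated by the relations `R` and by the axioms of
a symmetric operad over `k`. -/
inductive Rel {k : Type u} [CommRing k] {G : ℕ → Type}
    (R : ∀ n, OpExpr k G n → OpExpr k G n → Prop) :
    ∀ {n : ℕ}, OpExpr k G n → OpExpr k G n → Prop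
  /- the given relations -/
  | of {n : ℕ} {x y : OpExpr k G n} (h : R n x y) : Rel R x y
  /- equivalence relation -/
  | refl {n : ℕ} (x : OpExpr k G n) : Rel R x x
  | symm {n : ℕ} {x y : OpExpr k G n} : Rel R x y → Rel R y x
  | trans {n : ℕ} {x y z : OpExpr k G n} : Rel R x y → Rel R y z → Rel R x z
  /- compatibility with the operations -/
  | add_congr {n : ℕ} {x x' y y' : OpExpr k G n} :
      Rel R x x' → Rel R y y' → Rel R (add x y) (add x' y')
  | smul_congr {n : ℕ} (c : k) {x x' : OpExpr k G n} :
      Rel R x x' → Rel R (smul c x) (smul c x')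
  | act_congr {n : ℕ} (σ : Perm (Fin n)) {x x' : OpExpr k G n} :
      Rel R x x' → Rel R (act σ x) (act σ x')
  | comp_congr {m n r : ℕ} (i : Fin m) (h : m + n = r + 1) {x x' : OpExpr k G m}
      {y y' : OpExpr k G n} :
      Rel R x x' → Rel R y y' → Rel R (comp i h x y) (comp i h x' y')
  /- module axioms -/
  | add_assoc {n : ℕ} (x y z : OpExpr k G n) : Rel R (add (add x y) z) (add x (add y z))
  | add_comm {n : ℕ} (x y : OpExpr k G n) : Rel R (add x y) (add y x)
  | zero_add {n : ℕ} (x : OpExpr k G n) : Rel R (add zero x) x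
  | one_smul {n : ℕ} (x : OpExpr k G n) : Rel R (smul 1 x) x
  | mul_smul {n : ℕ} (c d : k) (x : OpExpr k G n) : Rel R (smul (c * d) x) (smul c (smul d x))
  | smul_add {n : ℕ} (c : k) (x y : OpExpr k G n) :
      Rel R (smul c (add x y)) (add (smul c x) (smul c y))
  | add_smul {n : ℕ} (c d : k) (x : OpExpr k G n) :
      Rel R (smul (c + d) x) (add (smul c x) (smul d x))
  | zero_smul {n : ℕ} (x : OpExpr k G n) : Rel R (smul 0 x) zero
  /- linear right action of the symmetric groups -/
  | act_add {n : ℕ} (σ : Perm (Fin n)) (x y : OpExpr k G n) :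
      Rel R (act σ (add x y)) (add (act σ x) (act σ y))
  | act_smul {n : ℕ} (σ : Perm (Fin n)) (c : k) (x : OpExpr k G n) :
      Rel R (act σ (smul c x)) (smul c (act σ x))
  | act_one {n : ℕ} (x : OpExpr k G n) : Rel R (act 1 x) x
  | act_mul {n : ℕ} (σ τ : Perm (Fin n)) (x : OpExpr k G n) :
      Rel R (act (σ * τ) x) (act τ (act σ x))
  /- bilinearity of the partial compositions -/
  | add_comp {m n r : ℕ} (i : Fin m) (h : m + n = r + 1) (x x' : OpExpr k G m)
      (y : OpExpr k G n) :
      Rel R (comp i h (add x x') y) (add (comp i h x y) (comp i h x' y))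
  | smul_comp {m n r : ℕ} (i : Fin m) (h : m + n = r + 1) (c : k) (x : OpExpr k G m)
      (y : OpExpr k G n) :
      Rel R (comp i h (smul c x) y) (smul c (comp i h x y))
  | comp_add {m n r : ℕ} (i : Fin m) (h : m + n = r + 1) (x : OpExpr k G m)
      (y y' : OpExpr k G n) :
      Rel R (comp i h x (add y y')) (add (comp i h x y) (comp i h x y'))
  | comp_smul {m n r : ℕ} (i : Fin m) (h : m + n = r + 1) (c : k) (x : OpExpr k G m)
      (y : OpExpr k G n) :
      Rel R (comp i h x (smul c y)) (smul c (comp i h x y))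
  /- operad axioms -/
  | comp_one {n : ℕ} (i : Fin n) (x : OpExpr k G n) : Rel R (comp i rfl x one) x
  | one_comp {n : ℕ} (x : OpExpr k G n) :
      Rel R (comp (0 : Fin 1) (Nat.add_comm 1 n) one x) x
  | comp_assoc_seq {l m n a b r : ℕ} (i : Fin l) (j : Fin m) (h₁ : l + m = a + 1)
      (h₂ : a + n = r + 1) (h₃ : m + n = b + 1) (h₄ : l + b = r + 1)
      (x : OpExpr k G l) (y : OpExpr k G m) (z : OpExpr k G n) :
      Rel R (comp (inPos i h₁ j) h₂ (comp i h₁ x y) z) (comp i h₄ x (comp j h₃ y z))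
  | comp_assoc_par {l m n a b r : ℕ} (i p : Fin l) (hip : i < p) (h₁ : l + m = a + 1)
      (h₂ : a + n = r + 1) (h₃ : l + n = b + 1) (h₄ : b + m = r + 1)
      (x : OpExpr k G l) (y : OpExpr k G m) (z : OpExpr k G n) :
      Rel R (comp ⟨p + m - 1, by omega⟩ h₂ (comp i h₁ x y) z)
        (comp ⟨i, by omega⟩ h₄ (comp p h₃ x z) y)
  | comp_act {m n r : ℕ} (i : Fin m) (h : m + n = r + 1) (σ : Perm (Fin n))
      (x : OpExpr k G m) (y : OpExpr k G n) :
      Rel R (comp i h x (act σ y)) (act (permComp i h 1 σ) (comp i h x y))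
  | act_comp {m n r : ℕ} (i : Fin m) (h : m + n = r + 1) (φ : Perm (Fin m))
      (x : OpExpr k G m) (y : OpExpr k G n) :
      Rel R (comp i h (act φ x) y) (act (permComp i h φ 1) (comp (φ i) h x y))

variable {k : Type u} [CommRing k] {G : ℕ → Type}
  (R : ∀ n, OpExpr k G n → OpExpr k G n → Prop)

/-- Equality in the presented operad. -/
def setoid (n : ℕ) : Setoid (OpExpr k G n) where
  r := Rel R
  iseqv := ⟨Rel.refl, Rel.symm, Rel.trans⟩

/-- The arity `n` part of the presented operad. -/
def Quo (n : ℕ) : Type u := Quotient (setoid R n)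

/-- The class of an expression. -/
def toQuo {n : ℕ} (x : OpExpr k G n) : Quo R n := Quotient.mk (setoid R n) x

variable {R}

theorem toQuo_eq {n : ℕ} {x y : OpExpr k G n} (h : Rel R x y) : toQuo R x = toQuo R y :=
  Quotient.sound h

theorem toQuo_ind {n : ℕ} {p : Quo R n → Prop} (h : ∀ x, p (toQuo R x)) (q : Quo R n) : p q :=
  Quotient.ind h q

instance (n : ℕ) : Add (Quo R n) :=
  ⟨Quotient.map₂ add fun _ _ h _ _ h' => Rel.add_congr h h'⟩

instance (n : ℕ) : Zero (Quo R n) := ⟨toQuo R zero⟩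

instance (n : ℕ) : SMul k (Quo R n) :=
  ⟨fun c => Quotient.map (smul c) fun _ _ h => Rel.smul_congr c h⟩

instance (n : ℕ) : Neg (Quo R n) := ⟨fun x => (-1 : k) • x⟩

instance (n : ℕ) : AddCommGroup (Quo R n) where
  add_assoc x y z := by
    induction x using toQuo_ind; induction y using toQuo_ind; induction z using toQuo_ind
    exact toQuo_eq (Rel.add_assoc ..)
  zero_add x := by
    induction x using toQuo_ind
    exact toQuo_eq (Rel.zero_add _)
  add_zero x := by
    induction x using toQuo_ind
    exact toQuo_eq ((Rel.add_comm ..).trans (Rel.zero_add _))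
  nsmul := nsmulRec
  zsmul := zsmulRec
  neg_add_cancel x := by
    induction x using toQuo_ind with | _ x
    refine toQuo_eq (x := add (smul (-1) x) x) (y := zero) ?_
    refine (Rel.add_congr (Rel.refl _) (Rel.one_smul x).symm).trans ?_
    refine (Rel.add_smul (-1) 1 x).symm.trans ?_
    rw [neg_add_cancel]
    exact Rel.zero_smul x
  add_comm x y := by
    induction x using toQuo_ind; induction y using toQuo_ind
    exact toQuo_eq (Rel.add_comm ..)

instance (n : ℕ) : Module k (Quo R n) where
  one_smul x := by
    induction x using toQuo_ind
    exact toQuo_eq (Rel.one_smul _)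
  mul_smul c d x := by
    induction x using toQuo_ind
    exact toQuo_eq (Rel.mul_smul ..)
  smul_zero c := by
    refine toQuo_eq (x := smul c zero) (y := zero) ?_
    refine (Rel.smul_congr c (Rel.zero_smul zero).symm).trans ?_
    refine (Rel.mul_smul c 0 zero).symm.trans ?_
    rw [mul_zero]
    exact Rel.zero_smul zero
  smul_add c x y := by
    induction x using toQuo_ind; induction y using toQuo_ind
    exact toQuo_eq (Rel.smul_add ..)
  add_smul c d x := by
    induction x using toQuo_ind
    exact toQuo_eq (Rel.add_smul ..)
  zero_smul x := by
    induction x using toQuo_ind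
    exact toQuo_eq (Rel.zero_smul _)

theorem toQuo_add {n : ℕ} (x y : OpExpr k G n) : toQuo R (add x y) = toQuo R x + toQuo R y := rfl

theorem toQuo_smul {n : ℕ} (c : k) (x : OpExpr k G n) : toQuo R (smul c x) = c • toQuo R x := rfl

theorem toQuo_zero {n : ℕ} : toQuo R (zero : OpExpr k G n) = 0 := rfl

/-- The action on the presented operad. -/
def quoAct {n : ℕ} (σ : Perm (Fin n)) : Quo R n →ₗ[k] Quo R n where
  toFun := Quotient.map (act σ) fun _ _ h => Rel.act_congr σ h
  map_add' x y := by
    induction x using toQuo_ind; induction y using toQuo_ind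
    exact toQuo_eq (Rel.act_add ..)
  map_smul' c x := by
    induction x using toQuo_ind
    exact toQuo_eq (Rel.act_smul ..)

/-- The partial compositions of the presented operad. -/
def quoComp {m n r : ℕ} (i : Fin m) (h : m + n = r + 1) :
    Quo R m →ₗ[k] Quo R n →ₗ[k] Quo R r :=
  LinearMap.mk₂ k (Quotient.map₂ (comp i h) fun _ _ hx _ _ hy => Rel.comp_congr i h hx hy)
    (fun x x' y => by
      induction x using toQuo_ind; induction x' using toQuo_ind; induction y using toQuo_ind
      exact toQuo_eq (Rel.add_comp ..))
    (fun c x y => by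
      induction x using toQuo_ind; induction y using toQuo_ind
      exact toQuo_eq (Rel.smul_comp ..))
    (fun x y y' => by
      induction x using toQuo_ind; induction y using toQuo_ind; induction y' using toQuo_ind
      exact toQuo_eq (Rel.comp_add ..))
    (fun c x y => by
      induction x using toQuo_ind; induction y using toQuo_ind
      exact toQuo_eq (Rel.comp_smul ..))

end OpExpr

/-- The symmetric operad over `k` generated by `G` subject to the relations `R`. -/
def presentedOperad {k : Type u} [CommRing k] {G : ℕ → Type}
    (R : ∀ n, OpExpr k G n → OpExpr k G n → Prop) : Operad.{u, u} k where
  Op := OpExpr.Quo R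
  act := OpExpr.quoAct
  act_one x := by
    induction x using OpExpr.toQuo_ind
    exact OpExpr.toQuo_eq (.act_one _)
  act_mul σ τ x := by
    induction x using OpExpr.toQuo_ind
    exact OpExpr.toQuo_eq (.act_mul ..)
  one := OpExpr.toQuo R .one
  comp := OpExpr.quoComp
  comp_one i x := by
    induction x using OpExpr.toQuo_ind
    exact OpExpr.toQuo_eq (.comp_one ..)
  one_comp x := by
    induction x using OpExpr.toQuo_ind
    exact OpExpr.toQuo_eq (.one_comp _)
  comp_assoc_seq i j h₁ h₂ h₃ h₄ x y z := by
    induction x using OpExpr.toQuo_ind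
    induction y using OpExpr.toQuo_ind
    induction z using OpExpr.toQuo_ind
    exact OpExpr.toQuo_eq (.comp_assoc_seq ..)
  comp_assoc_par i p hip h₁ h₂ h₃ h₄ x y z := by
    induction x using OpExpr.toQuo_ind
    induction y using OpExpr.toQuo_ind
    induction z using OpExpr.toQuo_ind
    exact OpExpr.toQuo_eq (.comp_assoc_par i p hip h₁ h₂ h₃ h₄ _ _ _)
  comp_act i h σ x y := by
    induction x using OpExpr.toQuo_ind
    induction y using OpExpr.toQuo_ind
    exact OpExpr.toQuo_eq (.comp_act ..)
  act_comp i h φ x y := by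
    induction x using OpExpr.toQuo_ind
    induction y using OpExpr.toQuo_ind
    exact OpExpr.toQuo_eq (.act_comp ..)

/-! ### The operads of Lie algebras and of unital Poisson algebras -/

section LiePois

variable (k : Type u) [CommRing k]

/-- The Jacobi identity `b ∘₂ b = b ∘₁ b + (b ∘₂ b) ∗ (12)` for a binary operation `b`, that is,
`[x₁,[x₂,x₃]] = [[x₁,x₂],x₃] + [x₂,[x₁,x₃]]`, as the pair of its two sides. -/
def jacobiSides {k : Type u} {G : ℕ → Type} (b : OpExpr k G 2) : OpExpr k G 3 × OpExpr k G 3 :=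
  (.comp (m := 2) (n := 2) 1 rfl b b,
    .add (.comp (m := 2) (n := 2) 0 rfl b b) (.act (Equiv.swap 0 1) (.comp (m := 2) (n := 2) 1 rfl b b)))

/-- The generator of the Lie operad. -/
inductive LieGen : ℕ → Type
  | bracket : LieGen 2

/-- The defining relations of the Lie operad. -/
inductive LieRel : ∀ n, OpExpr k LieGen n → OpExpr k LieGen n → Prop
  /- `b ∗ (12) = -b` -/
  | antisymm : LieRel 2 (.act (Equiv.swap 0 1) (.gen .bracket)) (.smul (-1) (.gen .bracket))
  | jacobi : LieRel 3 (jacobiSides (.gen .bracket)).1 (jacobiSides (.gen .bracket)).2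

/-- The operad `Lie` of Lie algebras. -/
def LieOperad : Operad.{u, u} k := presentedOperad (LieRel k)

/-- The generators of the Poisson operad: the unit `1₀`, the product `1₂` and the bracket `b`. -/
inductive PoisGen : ℕ → Type
  | unit : PoisGen 0
  | mul : PoisGen 2
  | bracket : PoisGen 2

/-- The defining relations of the operad of unital commutative Poisson algebras. -/
inductive PoisRel : ∀ n, OpExpr k PoisGen n → OpExpr k PoisGen n → Prop
  /- `1₂ ∘₁ 1₀ = 1 = 1₂ ∘₂ 1₀` -/
  | mul_unit_left : PoisRel 1 (.comp (m := 2) (n := 0) 0 rfl (.gen .mul) (.gen .unit)) .one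
  | mul_unit_right : PoisRel 1 (.comp (m := 2) (n := 0) 1 rfl (.gen .mul) (.gen .unit)) .one
  /- `b ∘₁ 1₀ = 0 = b ∘₂ 1₀` -/
  | bracket_unit_left : PoisRel 1 (.comp (m := 2) (n := 0) 0 rfl (.gen .bracket) (.gen .unit)) .zero
  | bracket_unit_right : PoisRel 1 (.comp (m := 2) (n := 0) 1 rfl (.gen .bracket) (.gen .unit)) .zero
  /- `1₂ ∗ (12) = 1₂` -/
  | mul_comm : PoisRel 2 (.act (Equiv.swap 0 1) (.gen .mul)) (.gen .mul)
  /- `b ∗ (12) = -b` -/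
  | antisymm : PoisRel 2 (.act (Equiv.swap 0 1) (.gen .bracket)) (.smul (-1) (.gen .bracket))
  /- `1₂ ∘₁ 1₂ = 1₂ ∘₂ 1₂` -/
  | mul_assoc : PoisRel 3 (.comp (m := 2) (n := 2) 0 rfl (.gen .mul) (.gen .mul))
      (.comp (m := 2) (n := 2) 1 rfl (.gen .mul) (.gen .mul))
  /- `b ∘₁ 1₂ = 1₂ ∘₂ b + (1₂ ∘₂ b) ∗ (12)` -/
  | leibniz : PoisRel 3 (.comp (m := 2) (n := 2) 0 rfl (.gen .bracket) (.gen .mul))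
      (.add (.comp (m := 2) (n := 2) 1 rfl (.gen .mul) (.gen .bracket))
        (.act (Equiv.swap 0 1) (.comp (m := 2) (n := 2) 1 rfl (.gen .mul) (.gen .bracket))))
  | jacobi : PoisRel 3 (jacobiSides (.gen .bracket)).1 (jacobiSides (.gen .bracket)).2

/-- The operad `Pois` of unital commutative Poisson algebras. -/
def PoisOperad : Operad.{u, u} k := presentedOperad (PoisRel k)

end LiePois

/-! Every operad carries the derivation E that multiplies arity n by n - 1 (`arityDer`). It is
inner, induced by minus the identity, and since it acts by 1 in arity two it is nonzero in every
characteristic as soon as that arity is nonzero. The claim is that E spans the derivations of As,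
Com and Lie, and that Pois has exactly one further dimension, spanned by the derivation B that
counts brackets (`bracketDer`).

Upper bounds. In As and Com the n-fold product is an iterated binary product, so the value of a
derivation on the binary product fixes everything; for As, associativity rules out the opposite
product as a component of that value. In a presented operad a derivation is fixed by its values on
the generators (`der_ext`), which are confined by knowing the arities up to two. Lie(2) is spanned
by the bracket b. For Pois, arities zero and one are spanned by the unit and the identity, and arity
two by the product and b; away from characteristic 2, symmetry and antisymmetry keep the latter two
apart, and the unit relation ties the eigenvalue on the unit to that on the product. If the product
and b have eigenvalues a and d, the derivation is a E + (d - a) B.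

Lower bounds. B exists because each relation of Pois is homogeneous in the number of brackets.
Independence only requires the product and b to be nonzero in the presented operads. No basis of Lie
or Pois is needed for this: it suffices to map to `oneBracket`, where two or more brackets give
zero. Finally Pois(1) consists of multiples of the identity, so the inner derivations are the
multiples of E, and B spans the first cohomology. -/

namespace Operad

/-! ### Derivations of an arbitrary operad and the arity derivation -/

variable {k : Type u} [CommRing k]

/-- Parallel associativity freed from the order of the two slots: when p comes first, the axiom is
read backwards with the two insertions exchanged. -/
theorem comp_outPos (P : Operad.{u, v} k) {l m n a b r : ℕ} (i p : Fin l) (hip : i ≠ p)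
    (h₁ : l + m = a + 1) (h₂ : a + n = r + 1) (h₃ : l + n = b + 1) (h₄ : b + m = r + 1)
    (x : P.Op l) (y : P.Op m) (z : P.Op n) :
    P.comp (outPos i h₁ p hip.symm) h₂ (P.comp i h₁ x y) z =
      P.comp (outPos p h₃ i hip) h₄ (P.comp p h₃ x z) y := by
  rcases lt_or_gt_of_ne hip with hlt | hlt
  · have e₁ : outPos i h₁ p hip.symm = ⟨p + m - 1, by omega⟩ := by
      apply Fin.ext
      have : ¬ (p : ℕ) < i := by omega
      simp [outPos, this]
    have e₂ : outPos p h₃ i hip = ⟨i, by omega⟩ := by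
      apply Fin.ext
      have : (i : ℕ) < p := by omega
      simp [outPos, this]
    rw [e₁, e₂]
    exact P.comp_assoc_par i p hlt h₁ h₂ h₃ h₄ x y z
  · have e₁ : outPos i h₁ p hip.symm = ⟨p, by omega⟩ := by
      apply Fin.ext
      have : (p : ℕ) < i := by omega
      simp [outPos, this]
    have e₂ : outPos p h₃ i hip = ⟨i + n - 1, by omega⟩ := by
      apply Fin.ext
      have : ¬ (i : ℕ) < p := by omega
      simp [outPos, this]
    rw [e₁, e₂]
    exact (P.comp_assoc_par p i hlt h₃ h₄ h₁ h₂ x z y).symm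

theorem mem_Der {P : Operad.{u, v} k} {D : P.GradedEnd} : D ∈ P.Der ↔
    (∀ (n : ℕ) (σ : Perm (Fin n)) (x : P.Op n), D n (P.act σ x) = P.act σ (D n x)) ∧
    ∀ (m n r : ℕ) (i : Fin m) (h : m + n = r + 1) (x : P.Op m) (y : P.Op n),
      D r (P.comp i h x y) = P.comp i h (D m x) y + P.comp i h x (D n y) := Iff.rfl

theorem der_act {P : Operad.{u, v} k} (D : P.Der) {n : ℕ} (σ : Perm (Fin n)) (x : P.Op n) :
    D.1 n (P.act σ x) = P.act σ (D.1 n x) := D.2.1 n σ x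

theorem der_comp {P : Operad.{u, v} k} (D : P.Der) {m n r : ℕ} (i : Fin m) (h : m + n = r + 1)
    (x : P.Op m) (y : P.Op n) :
    D.1 r (P.comp i h x y) = P.comp i h (D.1 m x) y + P.comp i h x (D.1 n y) :=
  D.2.2 m n r i h x y

theorem der_one {P : Operad.{u, v} k} (D : P.Der) : D.1 1 P.one = 0 := by
  have h := der_comp D (0 : Fin 1) rfl P.one P.one
  rw [P.comp_one, P.comp_one] at h
  have e : P.comp (0 : Fin 1) rfl P.one (D.1 1 P.one) = D.1 1 P.one := P.one_comp _
  rw [e] at h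
  simpa using h

/-- The derivation multiplying arity `n` by `n - 1`. -/
def arityDer (P : Operad.{u, v} k) : P.Der where
  val n := ((n : k) - 1) • LinearMap.id
  property := by
    rw [mem_Der]
    refine ⟨fun n σ x => by simp, fun m n r i h x y => ?_⟩
    -- The arity equation says (m - 1) + (n - 1) = r - 1, which is the Leibniz rule for these
    -- scalars.
    have h' : (m : k) + n = r + 1 := by exact_mod_cast congrArg (Nat.cast (R := k)) h
    simp only [LinearMap.smul_apply, LinearMap.id_apply, map_smul, ← add_smul]
    congr 1
    linear_combination -h'

/-- The identity is a two-sided unit, so it contributes θ once from the left and n times from the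
right. -/
theorem inner_smul_one (P : Operad.{u, v} k) (c : k) {n : ℕ} (θ : P.Op n) :
    P.comp (0 : Fin 1) (Nat.add_comm 1 n) (c • P.one) θ - ∑ i : Fin n, P.comp i rfl θ (c • P.one) =
      (-c) • ((n : k) - 1) • θ := by
  simp only [map_smul, LinearMap.smul_apply, P.one_comp, P.comp_one, Finset.sum_const,
    Finset.card_univ, Fintype.card_fin, smul_smul, ← Nat.cast_smul_eq_nsmul k, ← sub_smul]
  congr 1
  ring

theorem smul_arityDer_mem_IDer (P : Operad.{u, v} k) (c : k) : c • P.arityDer ∈ P.IDer := by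
  refine ⟨(-c) • P.one, fun n θ => ?_⟩
  rw [inner_smul_one, neg_neg]
  rfl

/-- If every derivation is a multiple of `arityDer`, which acts nontrivially in arity two, then
`Der` is one-dimensional and all derivations are inner. -/
theorem der_equiv_and_H1 {k : Type u} [Field k] (P : Operad.{u, v} k)
    (hne : ∃ x : P.Op 2, x ≠ 0) (h : ∀ D : P.Der, ∃ c : k, D = c • P.arityDer) :
    Nonempty (P.Der ≃ₗ[k] k) ∧ Subsingleton P.H1 := by
  constructor
  · refine ⟨(LinearEquiv.ofBijective (LinearMap.toSpanSingleton k P.Der P.arityDer)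
      ⟨?_, fun D => ?_⟩).symm⟩
    · rw [← LinearMap.ker_eq_bot, LinearMap.ker_eq_bot']
      intro c hc
      obtain ⟨x, hx⟩ := hne
      have h2 : c • (((2 : ℕ) : k) - 1) • x = 0 :=
        congrArg (fun D : P.Der => D.1 2 x) hc
      -- Arity two is the one to test on: the scalar n - 1 is invertible there in every
      -- characteristic.
      have e : ((2 : ℕ) : k) - 1 = 1 := by norm_num
      rw [e, one_smul] at h2
      exact (smul_eq_zero.mp h2).resolve_right hx
    · obtain ⟨c, rfl⟩ := h D
      exact ⟨c, rfl⟩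
  · rw [Submodule.Quotient.subsingleton_iff, eq_top_iff]
    rintro D -
    obtain ⟨c, rfl⟩ := h D
    exact P.smul_arityDer_mem_IDer c

end Operad

/-! ### Derivations of As and Com -/

section AsCom

variable (k : Type u) [Field k]

/-- Arity n is spanned by one product, with eigenvalue c n. Inserting the n-fold product into the
binary one gives c (n + 1) = c 2 + c n, and c 1 = 0 fixes the start. -/
theorem com_der (D : (Com k).Der) : ∃ c : k, D = c • (Com k).arityDer := by
  let d (n : ℕ) : (Com k).Op n →ₗ[k] (Com k).Op n := D.1 n
  let c (n : ℕ) : k := d n (1 : k)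
  have hc1 : c 1 = 0 := Operad.der_one D
  have hc (n : ℕ) : c (n + 1) = c 2 + c n := by
    have := Operad.der_comp D (m := 2) (n := n) (r := n + 1) 0 (by omega) (1 : k) (1 : k)
    have e : (Com k).comp (m := 2) (n := n) (r := n + 1) 0 (by omega) (1 : k) (1 : k) = (1 : k) :=
      one_mul (1 : k)
    rw [e] at this
    refine this.trans ?_
    exact congrArg₂ (· + ·) (mul_one (c 2)) (one_mul (c n))
  have h0 (n : ℕ) : c n = c 2 * ((n : k) - 1) := by
    -- Arity zero comes from inserting the unit into the binary product, which gives the identity.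
    have h00 : c 0 = -c 2 := by
      have := hc 0
      rw [zero_add, hc1] at this
      linear_combination -this
    induction n with
    | zero => rw [h00]; push_cast; ring
    | succ n ih => rw [hc, ih]; push_cast; ring
  refine ⟨c 2, Subtype.ext (funext fun n => LinearMap.ext fun (x : k) => ?_)⟩
  have e : d n x = x • d n (1 : k) :=
    (congrArg (d n) (mul_one x).symm).trans ((d n).map_smul x (1 : k))
  refine e.trans (Eq.trans ?_ (rfl : c 2 * (((n : k) - 1) * x) = _))
  refine (congrArg (x * ·) (h0 n)).trans ?_
  ring

theorem permComp_one_one {m n r : ℕ} (i : Fin m) (h : m + n = r + 1) :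
    permComp i h 1 1 = 1 := by
  ext x
  rcases pos_cases i h x with ⟨j, hj, rfl⟩ | ⟨t, rfl⟩
  · rw [permComp_outPos]; rfl
  · rw [permComp_inPos]; rfl

theorem perm_fin_two (σ : Perm (Fin 2)) : σ = 1 ∨ σ = Equiv.swap 0 1 := by
  revert σ; decide

theorem as_two (x : Perm (Fin 2) →₀ k) :
    x = Finsupp.single 1 (x 1) + Finsupp.single (Equiv.swap 0 1) (x (Equiv.swap 0 1)) := by
  have hne : (1 : Perm (Fin 2)) ≠ Equiv.swap 0 1 := by decide
  ext σ
  rcases perm_fin_two σ with rfl | rfl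
  · simp [hne.symm]
  · simp

/-- By equivariance it is enough to know the identity permutations. The binary one is an eigenvector
by associativity, and its eigenvalue propagates to all arities as for Com. -/
theorem as_der (D : (As k).Der) : ∃ c : k, D = c • (As k).arityDer := by
  let d (n : ℕ) : (Perm (Fin n) →₀ k) →ₗ[k] (Perm (Fin n) →₀ k) := D.1 n
  have hcomp {m n r : ℕ} (i : Fin m) (h : m + n = r + 1) (x : Perm (Fin m) →₀ k)
      (y : Perm (Fin n) →₀ k) : d r (asComp k i h x y) = asComp k i h (d m x) y +
        asComp k i h x (d n y) := Operad.der_comp D i h x y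
  have hact {n : ℕ} (σ : Perm (Fin n)) (c : k) :
      d n (Finsupp.single σ c) = c • Finsupp.mapDomain (· * σ) (d n (Finsupp.single 1 1)) := by
    have e : (Finsupp.single σ c : Perm (Fin n) →₀ k) =
        c • Finsupp.mapDomain (· * σ) (Finsupp.single 1 1) := by simp
    rw [e, map_smul]
    exact congrArg (c • ·) (Operad.der_act D σ _)
  have hone : d 1 (Finsupp.single 1 1) = 0 := Operad.der_one D
  obtain ⟨a, b, hab⟩ : ∃ a b : k, d 2 (Finsupp.single 1 1) =
      Finsupp.single 1 a + Finsupp.single (Equiv.swap 0 1) b := ⟨_, _, as_two k _⟩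
  have hb : b = 0 := by
    have h1 := hcomp (m := 2) (n := 2) (r := 3) 0 rfl (Finsupp.single 1 1) (Finsupp.single 1 1)
    have h2 := hcomp (m := 2) (n := 2) (r := 3) 1 rfl (Finsupp.single 1 1) (Finsupp.single 1 1)
    simp only [asComp_single, permComp_one_one] at h1 h2
    have h3 := h1.symm.trans h2
    simp only [hab, map_add, LinearMap.add_apply, asComp_single, permComp_one_one, mul_one,
      one_mul] at h3
    -- Differentiating the two sides of associativity, the word x₂x₀x₁ arises just once, from
    -- inserting x₀x₁ for x₀ in x₁x₀. Its coefficient b therefore vanishes.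
    have h4 := congrArg (fun f => f (permComp (m := 2) (n := 2) (r := 3) 0 rfl
      (Equiv.swap 0 1) 1)) h3
    simp only [Finsupp.add_apply, Finsupp.single_apply] at h4
    have e1 : (1 : Perm (Fin 3)) ≠ permComp (m := 2) (n := 2) (r := 3) 0 rfl
      (Equiv.swap 0 1) 1 := by decide
    have e2 : permComp (m := 2) (n := 2) (r := 3) 0 rfl 1 (Equiv.swap 0 1) ≠
      permComp (m := 2) (n := 2) (r := 3) 0 rfl (Equiv.swap 0 1) 1 := by decide
    have e3 : permComp (m := 2) (n := 2) (r := 3) 1 rfl (Equiv.swap 0 1) 1 ≠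
      permComp (m := 2) (n := 2) (r := 3) 0 rfl (Equiv.swap 0 1) 1 := by decide
    have e4 : permComp (m := 2) (n := 2) (r := 3) 1 rfl 1 (Equiv.swap 0 1) ≠
      permComp (m := 2) (n := 2) (r := 3) 0 rfl (Equiv.swap 0 1) 1 := by decide
    simpa [e1, e2, e3, e4] using h4
  subst hb
  rw [Finsupp.single_zero, add_zero] at hab
  have hstep (n : ℕ) : d (n + 1) (Finsupp.single 1 1) = Finsupp.single 1 a +
      asComp k (m := 2) (n := n) (r := n + 1) 0 (by omega) (Finsupp.single 1 1)
        (d n (Finsupp.single 1 1)) := by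
    have := hcomp (m := 2) (n := n) (r := n + 1) 0 (by omega) (Finsupp.single 1 1)
      (Finsupp.single 1 1)
    simpa only [asComp_single, permComp_one_one, mul_one, hab] using this
  have hid (n : ℕ) : d n (Finsupp.single 1 1) = Finsupp.single 1 (a * ((n : k) - 1)) := by
    have h0 : d 0 (Finsupp.single 1 1) = Finsupp.single 1 (-a) := by
      -- As(0) is one-dimensional; the recurrence at n = 0, where the left side is the derivative of
      -- the identity, determines c.
      obtain ⟨c, hc⟩ : ∃ c : k, d 0 (Finsupp.single 1 1) = Finsupp.single 1 c := by
        refine ⟨d 0 (Finsupp.single 1 1) 1, Finsupp.ext fun σ => ?_⟩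
        rw [Subsingleton.elim σ 1, Finsupp.single_eq_same]
      have := (show d 1 (Finsupp.single 1 1) = _ from hstep 0)
      rw [hone, hc, asComp_single, permComp_one_one, one_mul, ← Finsupp.single_add,
        eq_comm, Finsupp.single_eq_zero] at this
      rw [hc, eq_neg_of_add_eq_zero_right this]
    induction n with
    | zero => rw [h0]; congr 1; push_cast; ring
    | succ n ih =>
      rw [hstep, ih, asComp_single, permComp_one_one, ← Finsupp.single_add]
      congr 1; push_cast; ring
  refine ⟨a, Subtype.ext (funext fun n => LinearMap.ext fun (x : Perm (Fin n) →₀ k) => ?_)⟩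
  change d n x = (a • (((n : k) - 1) • x : Perm (Fin n) →₀ k) : Perm (Fin n) →₀ k)
  induction x using Finsupp.induction_linear with
  | zero => simp
  | add f g hf hg => rw [map_add, hf, hg, smul_add, smul_add]
  | single σ c =>
    rw [hact, hid, Finsupp.mapDomain_single, one_mul, Finsupp.smul_single, Finsupp.smul_single,
      Finsupp.smul_single]
    congr 1
    simp only [smul_eq_mul]
    ring

end AsCom

/-! ### Maps and derivations out of a presented operad -/

namespace OpExpr

variable {k : Type u} [CommRing k] {G : ℕ → Type}

/-- Evaluation of expressions in an operad, given values of the generators. -/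
def eval (Q : Operad.{u, v} k) (g : ∀ n, G n → Q.Op n) : ∀ {n : ℕ}, OpExpr k G n → Q.Op n
  | _, gen a => g _ a
  | _, one => Q.one
  | _, zero => 0
  | _, add x y => eval Q g x + eval Q g y
  | _, smul c x => c • eval Q g x
  | _, act σ x => Q.act σ (eval Q g x)
  | _, comp i h x y => Q.comp i h (eval Q g x) (eval Q g y)

theorem eval_eq {R : ∀ n, OpExpr k G n → OpExpr k G n → Prop} (Q : Operad.{u, v} k)
    (g : ∀ n, G n → Q.Op n) (hR : ∀ n x y, R n x y → eval Q g x = eval Q g y) {n : ℕ}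
    {x y : OpExpr k G n} (h : Rel R x y) : eval Q g x = eval Q g y := by
  induction h with
  | of h => exact hR _ _ _ h
  | refl => rfl
  | symm _ ih => exact ih.symm
  | trans _ _ ih ih' => exact ih.trans ih'
  | add_congr _ _ ih ih' => simp only [eval, ih, ih']
  | smul_congr _ _ ih => simp only [eval, ih]
  | act_congr _ _ ih => simp only [eval, ih]
  | comp_congr _ _ _ _ ih ih' => simp only [eval, ih, ih']
  | add_assoc => exact _root_.add_assoc _ _ _
  | add_comm => exact _root_.add_comm _ _
  | zero_add => exact _root_.zero_add _
  | one_smul => exact _root_.one_smul _ _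
  | mul_smul => exact SemigroupAction.mul_smul _ _ _
  | smul_add => exact _root_.smul_add _ _ _
  | add_smul => exact _root_.add_smul _ _ _
  | zero_smul => exact _root_.zero_smul _ _
  | act_add => exact map_add _ _ _
  | act_smul => exact map_smul _ _ _
  | act_one => exact Q.act_one _
  | act_mul => exact Q.act_mul _ _ _
  | add_comp => exact LinearMap.map_add₂ _ _ _ _
  | smul_comp => exact LinearMap.map_smul₂ _ _ _ _
  | comp_add => exact map_add _ _ _
  | comp_smul => exact map_smul _ _ _
  | comp_one => exact Q.comp_one _ _
  | one_comp => exact Q.one_comp _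
  | comp_assoc_seq => exact Q.comp_assoc_seq _ _ _ _ _ _ _ _ _
  | comp_assoc_par _ _ hip => exact Q.comp_assoc_par _ _ hip _ _ _ _ _ _ _
  | comp_act => exact Q.comp_act _ _ _ _ _
  | act_comp => exact Q.act_comp _ _ _ _ _

variable (R : ∀ n, OpExpr k G n → OpExpr k G n → Prop)

/-- The class of an expression in the presented operad. -/
def cls {n : ℕ} (x : OpExpr k G n) : (presentedOperad R).Op n := toQuo R x

/-- The value on an expression of the derivation multiplying each generator by a scalar. -/
def derivExpr (w : ∀ n, G n → k) : ∀ {n : ℕ}, OpExpr k G n → (presentedOperad R).Op n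
  | _, gen a => w _ a • cls R (gen a)
  | _, one => 0
  | _, zero => 0
  | _, add x y => derivExpr w x + derivExpr w y
  | _, smul c x => c • derivExpr w x
  | _, act σ x => (presentedOperad R).act σ (derivExpr w x)
  | _, comp i h x y => (presentedOperad R).comp i h (derivExpr w x) (cls R y) +
      (presentedOperad R).comp i h (cls R x) (derivExpr w y)

variable {R}

theorem cls_ind {n : ℕ} {p : (presentedOperad R).Op n → Prop} (h : ∀ x, p (cls R x))
    (q : (presentedOperad R).Op n) : p q := toQuo_ind h q

theorem cls_eq {n : ℕ} {x y : OpExpr k G n} (h : Rel R x y) : cls R x = cls R y := toQuo_eq h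

theorem cls_one : cls R one = (presentedOperad R).one := rfl

theorem cls_zero {n : ℕ} : cls R (zero : OpExpr k G n) = 0 := rfl

theorem cls_add {n : ℕ} (x y : OpExpr k G n) : cls R (add x y) = cls R x + cls R y := rfl

theorem cls_smul {n : ℕ} (c : k) (x : OpExpr k G n) : cls R (smul c x) = c • cls R x := rfl

theorem cls_act {n : ℕ} (σ : Perm (Fin n)) (x : OpExpr k G n) :
    cls R (act σ x) = (presentedOperad R).act σ (cls R x) := rfl

theorem cls_comp {m n r : ℕ} (i : Fin m) (h : m + n = r + 1) (x : OpExpr k G m)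
    (y : OpExpr k G n) :
    cls R (comp i h x y) = (presentedOperad R).comp i h (cls R x) (cls R y) := rfl

/-- Only the given relations need checking: the Leibniz rule is compatible with every operad axiom.
This is what lets a choice of weights descend to a derivation. -/
theorem derivExpr_eq (w : ∀ n, G n → k)
    (hR : ∀ n x y, R n x y → derivExpr R w x = derivExpr R w y) {n : ℕ}
    {x y : OpExpr k G n} (h : Rel R x y) : derivExpr R w x = derivExpr R w y := by
  induction h with
  | of h => exact hR _ _ _ h
  | refl => rfl
  | symm _ ih => exact ih.symm
  | trans _ _ ih ih' => exact ih.trans ih'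
  | add_congr _ _ ih ih' => simp only [derivExpr, ih, ih']
  | smul_congr _ _ ih => simp only [derivExpr, ih]
  | act_congr _ _ ih => simp only [derivExpr, ih]
  | comp_congr _ _ hx hy ih ih' => simp only [derivExpr, ih, ih', cls_eq hx, cls_eq hy]
  | add_assoc => exact _root_.add_assoc _ _ _
  | add_comm => exact _root_.add_comm _ _
  | zero_add => exact _root_.zero_add _
  | one_smul => exact _root_.one_smul _ _
  | mul_smul => exact SemigroupAction.mul_smul _ _ _
  | smul_add => exact _root_.smul_add _ _ _
  | add_smul => exact _root_.add_smul _ _ _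
  | zero_smul => exact _root_.zero_smul _ _
  | act_add => exact map_add _ _ _
  | act_smul => exact map_smul _ _ _
  | act_one => exact (presentedOperad R).act_one _
  | act_mul => exact (presentedOperad R).act_mul _ _ _
  | add_comp =>
    simp only [derivExpr, cls_add, map_add, LinearMap.add_apply]
    abel
  | smul_comp => simp only [derivExpr, cls_smul, map_smul, LinearMap.smul_apply, _root_.smul_add]
  | comp_add =>
    simp only [derivExpr, cls_add, map_add]
    abel
  | comp_smul => simp only [derivExpr, cls_smul, map_smul, _root_.smul_add]
  | comp_one i x =>
    simp only [derivExpr, map_zero, _root_.add_zero, cls_one]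
    exact (presentedOperad R).comp_one _ _
  | one_comp x =>
    simp only [derivExpr, map_zero, _root_.zero_add, cls_one, LinearMap.zero_apply]
    exact (presentedOperad R).one_comp _
  | comp_assoc_seq i j h₁ h₂ h₃ h₄ x y z =>
    simp only [derivExpr, cls_comp, map_add, LinearMap.add_apply,
      (presentedOperad R).comp_assoc_seq i j h₁ h₂ h₃ h₄, _root_.add_assoc]
  | comp_assoc_par i p hip h₁ h₂ h₃ h₄ x y z =>
    simp only [derivExpr, cls_comp, map_add, LinearMap.add_apply,
      (presentedOperad R).comp_assoc_par i p hip h₁ h₂ h₃ h₄]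
    abel
  | comp_act =>
    simp only [derivExpr, cls_act, map_add, (presentedOperad R).comp_act]
  | act_comp =>
    simp only [derivExpr, cls_act, map_add, (presentedOperad R).act_comp]

end OpExpr

namespace Operad

open OpExpr

variable {k : Type u} [CommRing k] {G : ℕ → Type} {R : ∀ n, OpExpr k G n → OpExpr k G n → Prop}

/-- The derivation of a presented operad multiplying each generator by a scalar. -/
def weightDer (w : ∀ n, G n → k) (hR : ∀ n x y, R n x y → derivExpr R w x = derivExpr R w y) :
    (presentedOperad R).Der where
  val n :=
    { toFun := Quotient.lift (s := setoid R n) (derivExpr R w) fun _ _ h => derivExpr_eq w hR h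
      map_add' := fun x y => by
        induction x using cls_ind; induction y using cls_ind; rfl
      map_smul' := fun c x => by
        induction x using cls_ind; rfl }
  property := by
    rw [mem_Der]
    refine ⟨fun n σ x => ?_, fun m n r i h x y => ?_⟩
    · induction x using cls_ind; rfl
    · induction x using cls_ind; induction y using cls_ind; rfl

theorem der_ext {D E : (presentedOperad R).Der}
    (h : ∀ n (a : G n), D.1 n (cls R (gen a)) = E.1 n (cls R (gen a))) : D = E := by
  refine Subtype.ext (funext fun n => LinearMap.ext fun x => ?_)
  induction x using cls_ind with | _ x
  induction x with
  | gen a => exact h _ a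
  | one => rw [cls_one, der_one, der_one]
  | zero => rw [cls_zero, map_zero, map_zero]
  | add x y hx hy => rw [cls_add, map_add, map_add, hx, hy]
  | smul c x hx => rw [cls_smul, map_smul, map_smul, hx]
  | act σ x hx => rw [cls_act, der_act, der_act, hx]
  | comp i h x y hx hy => rw [cls_comp, der_comp, der_comp, hx, hy]

/-- Any operad satisfying the relations serves as a model that certifies nonvanishing. -/
theorem cls_ne_zero (Q : Operad.{u, v} k) (g : ∀ n, G n → Q.Op n)
    (hR : ∀ n x y, R n x y → eval Q g x = eval Q g y) {n : ℕ} (x : OpExpr k G n)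
    (hx : eval Q g x ≠ 0) : cls R x ≠ 0 := fun h =>
  hx (eval_eq Q g hR (Quotient.exact h : Rel R x zero))

end Operad

/-! ### The operad of Poisson words with at most one bracket -/

section Model

variable {m n r : ℕ}

/-- The position in `Fin m` from which a position after insertion at `i` stems. -/
def outerPos (i : Fin m) (h : m + n = r + 1) (s : Fin r) : Fin m :=
  Sum.elim (fun j => j.1) (fun _ => i) ((posEquiv i h).symm s)

/-- The position inside the inserted block, if any. -/
def innerPos (i : Fin m) (h : m + n = r + 1) (s : Fin r) : Option (Fin n) :=
  Sum.elim (fun _ => none) some ((posEquiv i h).symm s)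

theorem posEquiv_symm_outPos (i : Fin m) (h : m + n = r + 1) (j : Fin m) (hj : j ≠ i) :
    (posEquiv i h).symm (outPos i h j hj) = Sum.inl ⟨j, hj⟩ :=
  (Equiv.symm_apply_eq _).mpr rfl

theorem posEquiv_symm_inPos (i : Fin m) (h : m + n = r + 1) (t : Fin n) :
    (posEquiv i h).symm (inPos i h t) = Sum.inr t :=
  (Equiv.symm_apply_eq _).mpr rfl

@[simp] theorem outer_outPos (i : Fin m) (h : m + n = r + 1) (j : Fin m) (hj : j ≠ i) :
    outerPos i h (outPos i h j hj) = j := by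
  simp [outerPos, posEquiv_symm_outPos]

@[simp] theorem outer_inPos (i : Fin m) (h : m + n = r + 1) (t : Fin n) :
    outerPos i h (inPos i h t) = i := by
  simp [outerPos, posEquiv_symm_inPos]

@[simp] theorem inner_outPos (i : Fin m) (h : m + n = r + 1) (j : Fin m) (hj : j ≠ i) :
    innerPos i h (outPos i h j hj) = none := by
  simp [innerPos, posEquiv_symm_outPos]

@[simp] theorem inner_inPos (i : Fin m) (h : m + n = r + 1) (t : Fin n) :
    innerPos i h (inPos i h t) = some t := by
  simp [innerPos, posEquiv_symm_inPos]

section Seq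

variable {l a b : ℕ} (i : Fin l) (j : Fin m) (h₁ : l + m = a + 1)
    (h₂ : a + n = r + 1)

/-- This and the following lemmas trace a position through two nested or two parallel insertions;
they are the combinatorial content of associativity in the model. -/
theorem outer_outer_seq (h₃ : m + n = b + 1) (h₄ : l + b = r + 1) (s : Fin r) :
    outerPos i h₁ (outerPos (inPos i h₁ j) h₂ s) = outerPos i h₄ s := by
  rcases pos_cases i h₄ s with ⟨p, hp, rfl⟩ | ⟨t, rfl⟩
  · rw [outer_outPos, seq_out i j h₁ h₂ h₄ p hp, outer_outPos, outer_outPos]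
  · rw [outer_inPos]
    rcases pos_cases j h₃ t with ⟨q, hq, rfl⟩ | ⟨t, rfl⟩
    · rw [seq_in_out i j h₁ h₂ h₃ h₄ q hq, outer_outPos, outer_inPos]
    · rw [seq_in_in i j h₁ h₂ h₃ h₄ t, outer_inPos, outer_inPos]

theorem inner_outer_seq (h₃ : m + n = b + 1) (h₄ : l + b = r + 1) (s : Fin r) :
    innerPos i h₁ (outerPos (inPos i h₁ j) h₂ s) = (innerPos i h₄ s).map (outerPos j h₃) := by
  rcases pos_cases i h₄ s with ⟨p, hp, rfl⟩ | ⟨t, rfl⟩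
  · rw [inner_outPos, seq_out i j h₁ h₂ h₄ p hp, outer_outPos, inner_outPos]; rfl
  · rw [inner_inPos, Option.map_some]
    rcases pos_cases j h₃ t with ⟨q, hq, rfl⟩ | ⟨t, rfl⟩
    · rw [seq_in_out i j h₁ h₂ h₃ h₄ q hq, outer_outPos, inner_inPos, outer_outPos]
    · rw [seq_in_in i j h₁ h₂ h₃ h₄ t, outer_inPos, inner_inPos, outer_inPos]

theorem inner_seq (h₃ : m + n = b + 1) (h₄ : l + b = r + 1) (s : Fin r) :
    innerPos (inPos i h₁ j) h₂ s = (innerPos i h₄ s).bind (innerPos j h₃) := by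
  rcases pos_cases i h₄ s with ⟨p, hp, rfl⟩ | ⟨t, rfl⟩
  · rw [inner_outPos, seq_out i j h₁ h₂ h₄ p hp, inner_outPos]; rfl
  · rw [inner_inPos, Option.bind_some]
    rcases pos_cases j h₃ t with ⟨q, hq, rfl⟩ | ⟨t, rfl⟩
    · rw [seq_in_out i j h₁ h₂ h₃ h₄ q hq, inner_outPos, inner_outPos]
    · rw [seq_in_in i j h₁ h₂ h₃ h₄ t, inner_inPos, inner_inPos]

end Seq

section Par

variable {l a b : ℕ} (i p : Fin l) (hip : i ≠ p) (h₁ : l + m = a + 1)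
    (h₂ : a + n = r + 1) (h₃ : l + n = b + 1) (h₄ : b + m = r + 1) (s : Fin r)

theorem outer_par :
    outerPos i h₁ (outerPos (outPos i h₁ p hip.symm) h₂ s) =
      outerPos p h₃ (outerPos (outPos p h₃ i hip) h₄ s) := by
  rcases pos_cases (outPos i h₁ p hip.symm) h₂ s with ⟨y, hy, rfl⟩ | ⟨t, rfl⟩
  · rcases pos_cases i h₁ y with ⟨q, hq, rfl⟩ | ⟨t, rfl⟩
    · have hqp : q ≠ p := by rintro rfl; exact hy rfl
      rw [outer_outPos, outer_outPos, par_out i p hip h₁ h₂ h₃ h₄ q hq hqp, outer_outPos,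
        outer_outPos]
    · rw [outer_outPos, outer_inPos, par_in_left i p hip h₁ h₂ h₃ h₄, outer_inPos, outer_outPos]
  · rw [outer_inPos, outer_outPos, par_in_right i p hip h₁ h₂ h₃ h₄, outer_outPos, outer_inPos]

theorem inner_outer_par :
    innerPos i h₁ (outerPos (outPos i h₁ p hip.symm) h₂ s) = innerPos (outPos p h₃ i hip) h₄ s := by
  rcases pos_cases (outPos i h₁ p hip.symm) h₂ s with ⟨y, hy, rfl⟩ | ⟨t, rfl⟩
  · rcases pos_cases i h₁ y with ⟨q, hq, rfl⟩ | ⟨t, rfl⟩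
    · have hqp : q ≠ p := by rintro rfl; exact hy rfl
      rw [outer_outPos, inner_outPos, par_out i p hip h₁ h₂ h₃ h₄ q hq hqp, inner_outPos]
    · rw [outer_outPos, inner_inPos, par_in_left i p hip h₁ h₂ h₃ h₄, inner_inPos]
  · rw [outer_inPos, inner_outPos, par_in_right i p hip h₁ h₂ h₃ h₄, inner_outPos]

end Par

theorem outer_permComp (i : Fin m) (h : m + n = r + 1) (φ : Perm (Fin m)) (ψ : Perm (Fin n))
    (s : Fin r) : outerPos (φ i) h (permComp i h φ ψ s) = φ (outerPos i h s) := by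
  rcases pos_cases i h s with ⟨j, hj, rfl⟩ | ⟨t, rfl⟩
  · rw [permComp_outPos, outer_outPos, outer_outPos]
  · rw [permComp_inPos, outer_inPos, outer_inPos]

theorem inner_permComp (i : Fin m) (h : m + n = r + 1) (φ : Perm (Fin m)) (ψ : Perm (Fin n))
    (s : Fin r) : innerPos (φ i) h (permComp i h φ ψ s) = (innerPos i h s).map ψ := by
  rcases pos_cases i h s with ⟨j, hj, rfl⟩ | ⟨t, rfl⟩
  · rw [permComp_outPos, inner_outPos, inner_outPos]; rfl
  · rw [permComp_inPos, inner_inPos, inner_inPos]; rfl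

theorem outer_one_right {n : ℕ} (i s : Fin n) : outerPos i (rfl : n + 1 = n + 1) s = s := by
  rcases pos_cases i (rfl : n + 1 = n + 1) s with ⟨j, hj, rfl⟩ | ⟨t, rfl⟩
  · rw [outer_outPos]; apply Fin.ext; simp [outPos]
  · rw [outer_inPos]; apply Fin.ext; simp [inPos]

theorem inner_one_left {n : ℕ} (s : Fin n) : innerPos (0 : Fin 1) (Nat.add_comm 1 n) s = some s := by
  rcases pos_cases (0 : Fin 1) (Nat.add_comm 1 n) s with ⟨j, hj, rfl⟩ | ⟨t, rfl⟩
  · exact absurd (Subsingleton.elim j 0) hj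
  · rw [inner_inPos]; congr 1; apply Fin.ext; simp [inPos]

variable {k : Type u} [CommRing k]

/-- Extension by zero of a function of pairs. -/
def extZero {α : Type*} (B : α → α → k) (s t : Option α) : k :=
  s.elim 0 fun s => t.elim 0 fun t => B s t

theorem extZero_map {α β : Type*} (f : α → β) (B : β → β → k) (s t : Option α) :
    extZero B (s.map f) (t.map f) = extZero (fun s t => B (f s) (f t)) s t := by
  cases s <;> cases t <;> rfl

theorem extZero_bind {α β : Type*} (f : α → Option β) (B : β → β → k) (s t : Option α) :
    extZero B (s.bind f) (t.bind f) = extZero (fun s t => extZero B (f s) (f t)) s t := by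
  cases s <;> cases t <;> simp [extZero]
  cases f _ <;> rfl

theorem extZero_add {α : Type*} (A B : α → α → k) (s t : Option α) :
    extZero (fun s t => A s t + B s t) s t = extZero A s t + extZero B s t := by
  cases s <;> cases t <;> simp [extZero]

theorem extZero_mul {α : Type*} (c : k) (B : α → α → k) (s t : Option α) :
    extZero (fun s t => c * B s t) s t = c * extZero B s t := by
  cases s <;> cases t <;> simp [extZero]

theorem extZero_zero {α : Type*} (s t : Option α) :
    extZero (fun _ _ : α => (0 : k)) s t = 0 := by
  cases s <;> cases t <;> simp [extZero]

variable (k) in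
/-- The operad of Poisson words with at most one bracket: `(c, A)` stands for the operation
`c x₁ ⋯ xₙ + ∑ A i j {xᵢ, xⱼ} ∏ xₗ`. -/
def oneBracket : Operad.{u, u} k where
  Op n := k × (Fin n → Fin n → k)
  act σ :=
    { toFun := fun x => (x.1, fun s t => x.2 (σ s) (σ t))
      map_add' := fun _ _ => rfl
      map_smul' := fun _ _ => rfl }
  act_one _ := rfl
  act_mul _ _ _ := rfl
  one := (1, fun _ _ => 0)
  comp i h := LinearMap.mk₂ k
    -- A bracket comes either from x, where the Leibniz rule spreads slot i over the whole inserted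
    -- block, or from y; terms taking one from each are dropped. The matrices need not be
    -- antisymmetric for the operad axioms to hold.
    (fun x y => (x.1 * y.1, fun s t => y.1 * x.2 (outerPos i h s) (outerPos i h t) +
      x.1 * extZero y.2 (innerPos i h s) (innerPos i h t)))
    (fun x x' y => by
      ext
      · simp [add_mul]
      · simp only [Prod.snd_add, Prod.fst_add, Pi.add_apply]; ring)
    (fun c x y => by
      ext
      · simp [mul_assoc]
      · simp only [Prod.smul_snd, Prod.smul_fst, Pi.smul_apply, smul_eq_mul]; ring)
    (fun x y y' => by
      ext s t
      · simp [mul_add]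
      · have := extZero_add y.2 y'.2 (innerPos i h s) (innerPos i h t)
        simp only [Prod.snd_add, Prod.fst_add, Pi.add_apply]
        refine (congrArg (fun z => (y.1 + y'.1) * x.2 _ _ + x.1 * z) this).trans ?_
        ring)
    (fun c x y => by
      ext s t
      · simp [mul_left_comm]
      · have := extZero_mul c y.2 (innerPos i h s) (innerPos i h t)
        simp only [Prod.smul_snd, Prod.smul_fst, Pi.smul_apply, smul_eq_mul]
        refine (congrArg (fun z => c * y.1 * x.2 _ _ + x.1 * z) this).trans ?_
        ring)
  comp_one i θ := by
    ext s t
    · simp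
    · simp [outer_one_right, extZero_zero]
  one_comp θ := by
    ext s t
    · simp
    · simp [inner_one_left, extZero]
  comp_assoc_seq i j h₁ h₂ h₃ h₄ x y z := by
    ext s t
    · simp [mul_assoc]
    · simp only [LinearMap.mk₂_apply, outer_outer_seq i j h₁ h₂ h₃ h₄,
        inner_outer_seq i j h₁ h₂ h₃ h₄, inner_seq i j h₁ h₂ h₃ h₄, extZero_map, extZero_bind,
        extZero_add, extZero_mul]
      ring
  comp_assoc_par {l m n a b r} i p hip h₁ h₂ h₃ h₄ x y z := by
    have e₁ : (⟨p + m - 1, by omega⟩ : Fin a) = outPos i h₁ p hip.ne' := by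
      apply Fin.ext
      have : ¬ (p : ℕ) < i := by omega
      simp [outPos, this]
    have e₂ : (⟨i, by omega⟩ : Fin b) = outPos p h₃ i hip.ne := by
      apply Fin.ext
      have : (i : ℕ) < p := by omega
      simp [outPos, this]
    rw [e₁, e₂]
    ext s t
    · simp [mul_right_comm]
    · simp only [LinearMap.mk₂_apply, outer_par i p hip.ne h₁ h₂ h₃ h₄,
        inner_outer_par i p hip.ne h₁ h₂ h₃ h₄, inner_outer_par p i hip.ne' h₃ h₄ h₁ h₂]
      ring
  comp_act i h σ x y := by
    ext s t
    · rfl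
    · have ho := outer_permComp i h 1 σ
      have hi := inner_permComp i h 1 σ
      simp only [Equiv.Perm.one_apply] at ho hi
      simp only [LinearMap.mk₂_apply, LinearMap.coe_mk, AddHom.coe_mk, ho, hi, extZero_map]
  act_comp i h φ x y := by
    ext s t
    · rfl
    · simp only [LinearMap.mk₂_apply, LinearMap.coe_mk, AddHom.coe_mk, outer_permComp,
        inner_permComp, Equiv.Perm.coe_one, Option.map_id, id]

end Model

/-! ### Suboperads containing the generators -/

namespace Operad

open OpExpr

variable {k : Type u} [CommRing k]

/-- A presented operad has no proper suboperad containing its generators. This is how spanning sets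
in low arity are obtained without normal forms. -/
theorem cls_mem {G : ℕ → Type} {R : ∀ n, OpExpr k G n → OpExpr k G n → Prop}
    (S : ∀ n, Submodule k ((presentedOperad R).Op n)) (hgen : ∀ n (a : G n), cls R (gen a) ∈ S n)
    (hone : (presentedOperad R).one ∈ S 1)
    (hact : ∀ n (σ : Perm (Fin n)), ∀ x ∈ S n, (presentedOperad R).act σ x ∈ S n)
    (hcomp : ∀ m n r (i : Fin m) (h : m + n = r + 1), ∀ x ∈ S m, ∀ y ∈ S n,
      (presentedOperad R).comp i h x y ∈ S r) {n : ℕ} (x : (presentedOperad R).Op n) :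
    x ∈ S n := by
  induction x using cls_ind with | _ x
  induction x with
  | gen a => exact hgen _ a
  | one => exact hone
  | zero => exact (S _).zero_mem
  | add x y hx hy => exact (S _).add_mem hx hy
  | smul c x hx => exact (S _).smul_mem c hx
  | act σ x hx => exact hact _ σ _ hx
  | comp i h x y hx hy => exact hcomp _ _ _ i h _ hx _ hy

theorem act_subsingleton (P : Operad.{u, v} k) {n : ℕ} (hn : n ≤ 1) (σ : Perm (Fin n))
    (x : P.Op n) : P.act σ x = x := by
  have := Fin.subsingleton_iff_le_one.mpr hn
  rw [Subsingleton.elim σ 1, P.act_one]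

theorem comp_mem_of_one_left (P : Operad.{u, v} k) (S : ∀ n, Submodule k (P.Op n)) {n r : ℕ}
    (i : Fin 1) (h : 1 + n = r + 1) {x : P.Op 1} (hx : x ∈ Submodule.span k {P.one})
    {y : P.Op n} (hy : y ∈ S n) : P.comp i h x y ∈ S r := by
  obtain rfl : r = n := by omega
  obtain ⟨c, rfl⟩ := Submodule.mem_span_singleton.mp hx
  rw [Subsingleton.elim i 0, map_smul, LinearMap.smul_apply, P.one_comp]
  exact (S _).smul_mem c hy

theorem comp_mem_of_one_right (P : Operad.{u, v} k) (S : ∀ n, Submodule k (P.Op n)) {m r : ℕ}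
    (i : Fin m) (h : m + 1 = r + 1) {x : P.Op m} (hx : x ∈ S m) {y : P.Op 1}
    (hy : y ∈ Submodule.span k {P.one}) : P.comp i h x y ∈ S r := by
  obtain rfl : r = m := by omega
  obtain ⟨c, rfl⟩ := Submodule.mem_span_singleton.mp hy
  rw [map_smul, P.comp_one]
  exact (S _).smul_mem c hx

end Operad

/-! ### Lie and Poisson relations in the model -/

namespace oneBracket

variable {k : Type u} [CommRing k]

/-- The coefficient of the product without bracket. -/
def coef {n : ℕ} (x : (oneBracket k).Op n) : k := Prod.fst x

/-- The coefficients of the terms with one bracket. -/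
def mat {n : ℕ} (x : (oneBracket k).Op n) : Fin n → Fin n → k := Prod.snd x

theorem ext {n : ℕ} {x y : (oneBracket k).Op n} (h : coef x = coef y)
    (h' : ∀ s t, mat x s t = mat y s t) : x = y :=
  Prod.ext h (funext fun s => funext fun t => h' s t)

@[simp] theorem coef_zero {n : ℕ} : coef (0 : (oneBracket k).Op n) = 0 := rfl

@[simp] theorem coef_add {n : ℕ} (x y : (oneBracket k).Op n) :
    coef (x + y) = coef x + coef y := rfl

@[simp] theorem coef_smul {n : ℕ} (c : k) (x : (oneBracket k).Op n) :
    coef (c • x) = c * coef x := rfl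

@[simp] theorem coef_act {n : ℕ} (σ : Perm (Fin n)) (x : (oneBracket k).Op n) :
    coef ((oneBracket k).act σ x) = coef x := rfl

@[simp] theorem coef_comp {m n r : ℕ} (i : Fin m) (h : m + n = r + 1) (x : (oneBracket k).Op m)
    (y : (oneBracket k).Op n) : coef ((oneBracket k).comp i h x y) = coef x * coef y := rfl

@[simp] theorem mat_zero {n : ℕ} (s t : Fin n) : mat (0 : (oneBracket k).Op n) s t = 0 := rfl

@[simp] theorem mat_add {n : ℕ} (x y : (oneBracket k).Op n) (s t : Fin n) :
    mat (x + y) s t = mat x s t + mat y s t := rfl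

@[simp] theorem mat_smul {n : ℕ} (c : k) (x : (oneBracket k).Op n) (s t : Fin n) :
    mat (c • x) s t = c * mat x s t := rfl

@[simp] theorem mat_act {n : ℕ} (σ : Perm (Fin n)) (x : (oneBracket k).Op n) (s t : Fin n) :
    mat ((oneBracket k).act σ x) s t = mat x (σ s) (σ t) := rfl

@[simp] theorem mat_comp {m n r : ℕ} (i : Fin m) (h : m + n = r + 1) (x : (oneBracket k).Op m)
    (y : (oneBracket k).Op n) (s t : Fin r) : mat ((oneBracket k).comp i h x y) s t =
      coef y * mat x (outerPos i h s) (outerPos i h t) +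
        coef x * extZero (mat y) (innerPos i h s) (innerPos i h t) := rfl

variable (k) in
/-- The product of all variables. -/
def prod (n : ℕ) : (oneBracket k).Op n := ((1 : k), fun _ _ => (0 : k))

variable (k) in
/-- The bracket of two variables. -/
def bracket : (oneBracket k).Op 2 := ((0 : k), (![![0, 1], ![-1, 0]] : Fin 2 → Fin 2 → k))

@[simp] theorem coef_prod (n : ℕ) : coef (prod k n) = 1 := rfl

@[simp] theorem mat_prod (n : ℕ) (s t : Fin n) : mat (prod k n) s t = 0 := rfl

@[simp] theorem coef_bracket : coef (bracket k) = 0 := rfl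

theorem mat_bracket (s t : Fin 2) :
    mat (bracket k) s t = (![![0, 1], ![-1, 0]] : Fin 2 → Fin 2 → k) s t := rfl

@[simp] theorem extZero_mat_prod (n : ℕ) (s t : Option (Fin n)) :
    extZero (mat (prod k n)) s t = 0 := extZero_zero s t

theorem bracket_ne_zero [Nontrivial k] : bracket k ≠ 0 := fun h =>
  one_ne_zero (congrArg (fun x => mat x 0 1) h : (1 : k) = 0)

theorem prod_ne_zero [Nontrivial k] (n : ℕ) : prod k n ≠ 0 := fun h =>
  one_ne_zero (congrArg coef h : (1 : k) = 0)

theorem act_prod {n : ℕ} (σ : Perm (Fin n)) : (oneBracket k).act σ (prod k n) = prod k n := rfl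

theorem prod_comp_prod {m n r : ℕ} (i : Fin m) (h : m + n = r + 1) :
    (oneBracket k).comp i h (prod k m) (prod k n) = prod k r :=
  ext (by simp) (by simp)

theorem act_bracket :
    (oneBracket k).act (Equiv.swap 0 1) (bracket k) = (-1 : k) • bracket k := by
  refine ext (by simp [-neg_smul]) fun s t => ?_
  fin_cases s <;> fin_cases t <;> simp [mat_bracket, -neg_smul]

theorem bracket_comp_prod_zero (i : Fin 2) (h : 2 + 0 = 1 + 1) :
    (oneBracket k).comp i h (bracket k) (prod k 0) = 0 := by
  refine ext (by simp) fun s t => ?_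
  -- With a single slot left, only diagonal entries of the bracket matrix occur, and these are zero.
  rw [Subsingleton.elim s t]
  simp only [mat_comp, coef_prod, one_mul, coef_bracket, zero_mul, add_zero, mat_zero]
  generalize outerPos i h t = j
  fin_cases j <;> rfl

/-- Each term contains the bracket-free coefficient of one of the two factors, which is zero. Hence
the Jacobi identity is trivial in the model. -/
theorem bracket_comp_bracket {r : ℕ} (i : Fin 2) (h : 2 + 2 = r + 1) :
    (oneBracket k).comp i h (bracket k) (bracket k) = 0 :=
  ext (by simp) (by simp)

theorem jacobi : (oneBracket k).comp (m := 2) (n := 2) (r := 3) 1 rfl (bracket k) (bracket k) =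
    (oneBracket k).comp (m := 2) (n := 2) (r := 3) 0 rfl (bracket k) (bracket k) +
      (oneBracket k).act (Equiv.swap 0 1)
        ((oneBracket k).comp (m := 2) (n := 2) (r := 3) 1 rfl (bracket k) (bracket k)) := by
  rw [bracket_comp_bracket, bracket_comp_bracket, map_zero, add_zero]

theorem leibniz :
    (oneBracket k).comp (m := 2) (n := 2) (r := 3) 0 rfl (bracket k) (prod k 2) =
      (oneBracket k).comp (m := 2) (n := 2) (r := 3) 1 rfl (prod k 2) (bracket k) +
        (oneBracket k).act (Equiv.swap 0 1)
          ((oneBracket k).comp (m := 2) (n := 2) (r := 3) 1 rfl (prod k 2) (bracket k)) := by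
  have ho : ∀ s : Fin 3, outerPos (m := 2) (n := 2) 0 rfl s = ![0, 0, 1] s := by decide
  have hi : ∀ s : Fin 3, innerPos (m := 2) (n := 2) 1 rfl s = ![none, some 0, some 1] s := by
    decide
  have hs : (Equiv.swap (0 : Fin 3) 1) 2 = 2 := by decide
  refine ext (by simp) fun s t => ?_
  simp only [mat_add, mat_act, mat_comp, ho, hi, coef_prod, coef_bracket, mat_prod,
    extZero_mat_prod]
  fin_cases s <;> fin_cases t <;> simp [extZero, mat_bracket, hs]

end oneBracket

/-! ### Derivations of Lie -/

namespace LieOperad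

open OpExpr Operad

variable {k : Type u} [CommRing k]

variable (k) in
/-- The bracket in the Lie operad. -/
def br : (presentedOperad (LieRel k)).Op 2 := cls (LieRel k) (gen LieGen.bracket)

theorem act_br : (presentedOperad (LieRel k)).act (Equiv.swap 0 1) (br k) = (-1 : k) • br k :=
  cls_eq (.of .antisymm)

variable (k) in
/-- The known subspaces of the Lie operad in arities at most two. -/
def low : ∀ n, Submodule k ((presentedOperad (LieRel k)).Op n)
  | 0 => ⊥
  | 1 => Submodule.span k {(presentedOperad (LieRel k)).one}
  | 2 => Submodule.span k {br k}
  | _ + 3 => ⊤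

/-- With no generator of arity zero, composing never lowers the arity: two factors of arity at least
two land in arity at least three, where `low` imposes nothing. -/
theorem mem_low {n : ℕ} (x : (presentedOperad (LieRel k)).Op n) : x ∈ low k n := by
  refine cls_mem (low k) ?_ (Submodule.mem_span_singleton_self _) ?_ ?_ x
  · rintro _ ⟨⟩
    exact Submodule.mem_span_singleton_self _
  · rintro (_ | _ | _ | n) σ x hx
    · rwa [act_subsingleton _ (Nat.zero_le 1)]
    · rwa [act_subsingleton _ le_rfl]
    · obtain ⟨c, rfl⟩ := Submodule.mem_span_singleton.mp hx
      rcases perm_fin_two σ with rfl | rfl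
      · rwa [act_one]
      · rw [map_smul, act_br]
        exact Submodule.smul_mem _ _ (Submodule.smul_mem _ _ (Submodule.mem_span_singleton_self _))
    · trivial
  · rintro m n r i h x hx y hy
    obtain rfl | rfl | hn : n = 0 ∨ n = 1 ∨ 2 ≤ n := by omega
    · rw [show y = 0 from hy, map_zero]
      exact Submodule.zero_mem _
    · exact comp_mem_of_one_right _ (low k) i h hx hy
    · obtain rfl | hm : m = 1 ∨ 2 ≤ m := by
        have := i.pos; omega
      · exact comp_mem_of_one_left _ (low k) i h hx hy
      · obtain ⟨r, rfl⟩ : ∃ r', r = r' + 3 := ⟨r - 3, by omega⟩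
        trivial

variable (k) in
/-- The value of the generator in the operad of words with at most one bracket. -/
def toOneBracket : ∀ n, LieGen n → (oneBracket k).Op n
  | _, .bracket => oneBracket.bracket k

theorem br_ne_zero [Nontrivial k] : br k ≠ 0 := by
  refine cls_ne_zero (oneBracket k) (toOneBracket k) ?_ _ oneBracket.bracket_ne_zero
  rintro _ _ _ (_ | _)
  · exact oneBracket.act_bracket
  · exact oneBracket.jacobi

theorem exists_smul_arityDer (D : (presentedOperad (LieRel k)).Der) :
    ∃ c : k, D = c • (presentedOperad (LieRel k)).arityDer := by
  obtain ⟨c, hc⟩ := Submodule.mem_span_singleton.mp (mem_low (D.1 2 (br k)))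
  refine ⟨c, der_ext ?_⟩
  rintro _ ⟨⟩
  refine hc.symm.trans ?_
  have e : (((2 : ℕ) : k) - 1) = 1 := by push_cast; ring
  exact congrArg (c • ·) (((congrArg (· • br k) e).trans (one_smul k _)).symm)

end LieOperad

/-! ### Low arities of Pois and the bracket-counting derivation -/

namespace PoisOperad

open OpExpr Operad

variable {k : Type u} [CommRing k]

variable (k) in
/-- The presented operad underlying `PoisOperad`. -/
abbrev P : Operad.{u, u} k := presentedOperad (PoisRel k)

variable (k) in
/-- The unit `1₀`. -/
def un : (P k).Op 0 := cls (PoisRel k) (gen .unit)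

variable (k) in
/-- The product `1₂`. -/
def mu : (P k).Op 2 := cls (PoisRel k) (gen .mul)

variable (k) in
/-- The bracket `b`. -/
def br : (P k).Op 2 := cls (PoisRel k) (gen .bracket)

theorem act_mu : (P k).act (Equiv.swap 0 1) (mu k) = mu k := cls_eq (.of .mul_comm)

theorem act_br : (P k).act (Equiv.swap 0 1) (br k) = (-1 : k) • br k := cls_eq (.of .antisymm)

theorem mu_comp_un (i : Fin 2) (h : 2 + 0 = 1 + 1) : (P k).comp i h (mu k) (un k) = (P k).one := by
  fin_cases i
  · exact cls_eq (.of .mul_unit_left)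
  · exact cls_eq (.of .mul_unit_right)

theorem br_comp_un (i : Fin 2) (h : 2 + 0 = 1 + 1) : (P k).comp i h (br k) (un k) = 0 := by
  fin_cases i
  · exact cls_eq (.of .bracket_unit_left)
  · exact cls_eq (.of .bracket_unit_right)

theorem one_comp_un (i : Fin 1) (h : 1 + 0 = 0 + 1) : (P k).comp i h (P k).one (un k) = un k := by
  rw [Subsingleton.elim i 0]
  exact (P k).one_comp _

variable (k) in
/-- The operations which reduce to the known ones of arity at most two by inserting units. -/
def low : ∀ n, Submodule k ((P k).Op n)
  | 0 => Submodule.span k {un k}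
  | 1 => Submodule.span k {(P k).one}
  | 2 => Submodule.span k {mu k, br k}
  | n + 3 => ⨅ i : Fin (n + 3), (low (n + 2)).comap (((P k).comp i (n := 0) rfl).flip (un k))

theorem mem_low_add_three {n : ℕ} {x : (P k).Op (n + 3)} :
    x ∈ low k (n + 3) ↔ ∀ i, (P k).comp i (n := 0) rfl x (un k) ∈ low k (n + 2) := by
  simp [low, Submodule.mem_iInf]

theorem comp_un_mem_low {m r : ℕ} (i : Fin m) (h : m + 0 = r + 1) {x : (P k).Op m}
    (hx : x ∈ low k m) : (P k).comp i h x (un k) ∈ low k r := by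
  obtain rfl : m = r + 1 := h
  match r with
  | 0 =>
    obtain ⟨c, rfl⟩ := Submodule.mem_span_singleton.mp hx
    rw [map_smul, LinearMap.smul_apply, one_comp_un]
    exact Submodule.smul_mem _ _ (Submodule.mem_span_singleton_self _)
  | 1 =>
    obtain ⟨c, d, rfl⟩ := Submodule.mem_span_pair.mp hx
    rw [map_add, map_smul, map_smul, LinearMap.add_apply, LinearMap.smul_apply,
      LinearMap.smul_apply, mu_comp_un, br_comp_un, smul_zero, add_zero]
    exact Submodule.smul_mem _ _ (Submodule.mem_span_singleton_self _)
  | r + 2 => exact mem_low_add_three.mp hx i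

/-- Since units lower the arity, low arities cannot be treated in isolation as for Lie. The
recursive condition on `low` absorbs this: associativity pushes a unit inserted into a composite
into one factor, and induction on the arity of the composite applies. -/
theorem comp_mem_low (r : ℕ) : ∀ m n (i : Fin m) (h : m + n = r + 1), ∀ x ∈ low k m, ∀ y ∈ low k n,
    (P k).comp i h x y ∈ low k r := by
  induction r with
  | zero =>
    intro m n i h x hx y hy
    obtain ⟨rfl, rfl⟩ : m = 1 ∧ n = 0 := by have := i.pos; omega
    exact comp_mem_of_one_left _ (low k) i h hx hy
  | succ r ih =>
    intro m n i h x hx y hy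
    obtain rfl | rfl | hn : n = 0 ∨ n = 1 ∨ 2 ≤ n := by omega
    · obtain ⟨c, rfl⟩ := Submodule.mem_span_singleton.mp hy
      rw [map_smul]
      exact Submodule.smul_mem _ _ (comp_un_mem_low i h hx)
    · exact comp_mem_of_one_right _ (low k) i h hx hy
    obtain rfl | hm : m = 1 ∨ 2 ≤ m := by have := i.pos; omega
    · exact comp_mem_of_one_left _ (low k) i h hx hy
    obtain ⟨r, rfl⟩ : ∃ r', r = r' + 2 := ⟨r - 2, by omega⟩
    obtain ⟨m, rfl⟩ : ∃ m', m = m' + 1 := ⟨m - 1, by omega⟩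
    obtain ⟨n, rfl⟩ : ∃ n', n = n' + 1 := ⟨n - 1, by omega⟩
    refine mem_low_add_three.mpr fun q => ?_
    -- Either the unit enters a remaining slot of x, by parallel associativity, or a slot of y, by
    -- sequential associativity.
    rcases pos_cases i h q with ⟨p, hp, rfl⟩ | ⟨t, rfl⟩
    · rw [comp_outPos (P k) (n := 0) i p hp.symm h rfl (b := m) rfl (by omega)]
      exact ih _ _ _ _ _ (comp_un_mem_low p rfl hx) _ hy
    · rw [(P k).comp_assoc_seq (n := 0) i t h rfl (b := n) rfl (by omega)]
      exact ih _ _ _ _ _ hx _ (comp_un_mem_low t rfl hy)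

theorem act_mem_low (n : ℕ) : ∀ (σ : Perm (Fin n)), ∀ x ∈ low k n, (P k).act σ x ∈ low k n := by
  induction n with
  | zero => intro σ x hx; rwa [act_subsingleton _ (Nat.zero_le 1)]
  | succ n ih =>
    intro σ x hx
    match n with
    | 0 => rwa [act_subsingleton _ le_rfl]
    | 1 =>
      rcases perm_fin_two σ with rfl | rfl
      · rwa [act_one]
      · obtain ⟨c, d, rfl⟩ := Submodule.mem_span_pair.mp hx
        rw [map_add, map_smul, map_smul, act_mu, act_br]
        exact Submodule.mem_span_pair.mpr ⟨c, d * -1, by rw [mul_smul]⟩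
    | n + 2 =>
      refine mem_low_add_three.mpr fun i => ?_
      -- By equivariance the unit goes into slot σ i of x, followed by a permutation in one arity
      -- less.
      rw [act_comp]
      exact ih _ _ (mem_low_add_three.mp hx _)

theorem mem_low {n : ℕ} (x : (P k).Op n) : x ∈ low k n := by
  refine cls_mem (low k) ?_ (Submodule.mem_span_singleton_self _) act_mem_low
    (fun m n r => comp_mem_low r m n) x
  rintro _ (_ | _ | _)
  · exact Submodule.mem_span_singleton_self _
  · exact Submodule.mem_span_of_mem (by simp [mu])
  · exact Submodule.mem_span_of_mem (by simp [br])

variable (k) in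
/-- The values of the generators in the operad of words with at most one bracket. -/
def toOneBracket : ∀ n, PoisGen n → (oneBracket k).Op n
  | _, .unit => oneBracket.prod k 0
  | _, .mul => oneBracket.prod k 2
  | _, .bracket => oneBracket.bracket k

theorem eval_toOneBracket_eq : ∀ n x y, PoisRel k n x y →
    eval (oneBracket k) (toOneBracket k) x = eval (oneBracket k) (toOneBracket k) y := by
  rintro _ _ _ ⟨⟩
  · exact oneBracket.prod_comp_prod _ _
  · exact oneBracket.prod_comp_prod _ _
  · exact oneBracket.bracket_comp_prod_zero _ _
  · exact oneBracket.bracket_comp_prod_zero _ _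
  · exact oneBracket.act_prod _
  · exact oneBracket.act_bracket
  · exact (oneBracket.prod_comp_prod _ _).trans (oneBracket.prod_comp_prod _ _).symm
  · exact oneBracket.leibniz
  · exact oneBracket.jacobi

theorem mu_ne_zero [Nontrivial k] : mu k ≠ 0 :=
  cls_ne_zero (oneBracket k) (toOneBracket k) eval_toOneBracket_eq _ (oneBracket.prod_ne_zero 2)

theorem br_ne_zero [Nontrivial k] : br k ≠ 0 :=
  cls_ne_zero (oneBracket k) (toOneBracket k) eval_toOneBracket_eq _ oneBracket.bracket_ne_zero

variable (k) in
/-- The weight counting brackets. -/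
def bracketWeight : ∀ n, PoisGen n → k
  | _, .unit => 0
  | _, .mul => 0
  | _, .bracket => 1

/-- All nonzero terms of a relation have equally many brackets: none, one, or two for Jacobi.
Counting brackets thus turns each relation into a multiple of itself. -/
theorem derivExpr_bracketWeight_eq : ∀ n x y, PoisRel k n x y →
    derivExpr (PoisRel k) (bracketWeight k) x = derivExpr (PoisRel k) (bracketWeight k) y := by
  have hj := cls_eq (R := PoisRel k) (.of .jacobi)
  have hl := cls_eq (R := PoisRel k) (.of .leibniz)
  simp only [jacobiSides, cls_comp, cls_add, cls_act] at hj hl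
  rintro _ _ _ ⟨⟩
  · simp [derivExpr, bracketWeight]
  · simp [derivExpr, bracketWeight]
  · simpa [derivExpr, bracketWeight, br, un] using br_comp_un (k := k) 0 rfl
  · simpa [derivExpr, bracketWeight, br, un] using br_comp_un (k := k) 1 rfl
  · simp [derivExpr, bracketWeight]
  · simpa [derivExpr, bracketWeight, br] using act_br (k := k)
  · simp [derivExpr, bracketWeight]
  · simpa [derivExpr, bracketWeight] using hl
  · simp only [derivExpr, bracketWeight, jacobiSides, one_smul, map_add]
    -- Each Jacobi term has two brackets, so its derivative is twice itself.
    exact (congrArg₂ (· + ·) hj hj).trans (by abel)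

variable (k) in
/-- The derivation counting brackets. -/
def bracketDer : (P k).Der := weightDer (bracketWeight k) derivExpr_bracketWeight_eq

theorem bracketDer_un : (bracketDer k).1 0 (un k) = 0 := zero_smul k (un k)

theorem bracketDer_mu : (bracketDer k).1 2 (mu k) = 0 := zero_smul k (mu k)

theorem bracketDer_br : (bracketDer k).1 2 (br k) = br k := one_smul k (br k)

theorem pair_apply (c d : k) {n : ℕ} (x : (P k).Op n) :
    (c • (P k).arityDer + d • bracketDer k).1 n x =
      (c * ((n : k) - 1)) • x + d • (bracketDer k).1 n x := by
  rw [mul_smul]; rfl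

end PoisOperad

/-! ### Derivations and first cohomology of Pois -/

namespace PoisOperad

open OpExpr Operad

variable {k : Type u} [Field k]

theorem exists_pair (h2 : (2 : k) ≠ 0) (D : (P k).Der) :
    ∃ c d : k, D = c • (P k).arityDer + d • bracketDer k := by
  -- The sole use of characteristic different from 2: a component whose sign flips under (12) while
  -- the equation persists must vanish.
  have heven {a b : k} {x y : (P k).Op 2} (h : a • x - b • y = a • x + b • y) : b • y = 0 := by
    have : (2 : k) • b • y = 0 := by
      rw [two_smul]; rw [sub_eq_add_neg, add_right_inj, neg_eq_iff_add_eq_zero] at h; exact h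
    exact (smul_eq_zero.mp this).resolve_left h2
  obtain ⟨u, hu⟩ := Submodule.mem_span_singleton.mp (mem_low (D.1 0 (un k)))
  obtain ⟨a, b, hab⟩ := Submodule.mem_span_pair.mp (mem_low (D.1 2 (mu k)))
  obtain ⟨c, d, hcd⟩ := Submodule.mem_span_pair.mp (mem_low (D.1 2 (br k)))
  have hb : b • br k = 0 := by
    have := der_act D (Equiv.swap 0 1) (mu k)
    rw [act_mu, ← hab, map_add, map_smul, map_smul, act_mu, act_br] at this
    refine heven (a := a) (x := mu k) (this.trans ?_).symm
    module
  have hc : c • mu k = 0 := by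
    have := der_act D (Equiv.swap 0 1) (br k)
    rw [act_br, map_smul, ← hcd, map_add, map_smul, map_smul, act_mu, act_br] at this
    refine heven (a := d) (x := br k) ?_
    -- After negation the bracket terms on the two sides agree and the product terms are opposite.
    have h' := congrArg (fun z => (-1 : k) • z) this
    simp only [smul_add, smul_smul] at h'
    refine Eq.trans ?_ (h'.symm.trans ?_) <;> module
  rw [hb, add_zero] at hab
  rw [hc, zero_add] at hcd
  have hone : (P k).comp (m := 2) (n := 0) 0 rfl (mu k) (un k) = (P k).one := mu_comp_un 0 rfl
  -- The derivation kills the identity, which is the product with a unit inserted.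
  have hua : (a + u) • (P k).one = 0 := by
    have := der_comp D (m := 2) (n := 0) 0 rfl (mu k) (un k)
    rw [hone, der_one, ← hab, ← hu, map_smul, map_smul, LinearMap.smul_apply, hone,
      ← add_smul] at this
    exact this.symm
  -- Composing with the unit moves the relation to arity zero, without having to know that the
  -- identity is nonzero.
  have hun : u • un k = (-a) • un k := by
    have := congrArg (fun z => (P k).comp (0 : Fin 1) (n := 0) rfl z (un k)) hua
    simp only [map_smul, LinearMap.smul_apply, one_comp_un, map_zero, LinearMap.zero_apply] at this
    rw [add_smul] at this
    rw [neg_smul]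
    exact eq_neg_of_add_eq_zero_right this
  -- E already contributes a on the bracket, so B has to supply the difference.
  refine ⟨a, d - a, der_ext ?_⟩
  rintro _ (_ | _ | _)
  · refine hu.symm.trans (hun.trans ((pair_apply a (d - a) (un k)).trans ?_).symm)
    rw [bracketDer_un, smul_zero, add_zero]
    congr 1; push_cast; ring
  · refine hab.symm.trans ((pair_apply a (d - a) (mu k)).trans ?_).symm
    rw [bracketDer_mu, smul_zero, add_zero]
    congr 1; push_cast; ring
  · refine hcd.symm.trans ((pair_apply a (d - a) (br k)).trans ?_).symm
    rw [bracketDer_br, ← add_smul]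
    congr 1; push_cast; ring

/-- Both derivations are diagonal on the generators, so it is enough that the product and the
bracket are separately nonzero: the product detects c, then the bracket detects d. -/
theorem pair_eq_zero {c d : k} (h : c • (P k).arityDer + d • bracketDer k = 0) :
    c = 0 ∧ d = 0 := by
  have hD {n : ℕ} (x : (P k).Op n) :
      (c * ((n : k) - 1)) • x + d • (bracketDer k).1 n x = 0 := by
    rw [← pair_apply, h]; rfl
  have hc := hD (mu k)
  rw [bracketDer_mu, smul_zero, add_zero] at hc
  have hc := (smul_eq_zero.mp hc).resolve_right mu_ne_zero
  have hc : c = 0 := by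
    push_cast at hc; linear_combination hc
  subst hc
  have hd := hD (br k)
  rw [bracketDer_br, zero_mul, zero_smul, zero_add] at hd
  exact ⟨rfl, (smul_eq_zero.mp hd).resolve_right br_ne_zero⟩

variable (k) in
/-- Combinations of the two basic derivations. -/
noncomputable def pair : k × k →ₗ[k] (P k).Der :=
  (LinearMap.toSpanSingleton k _ (P k).arityDer).coprod
    (LinearMap.toSpanSingleton k _ (bracketDer k))

theorem pair_def (x : k × k) : pair k x = x.1 • (P k).arityDer + x.2 • bracketDer k := rfl

theorem pair_bijective (h2 : (2 : k) ≠ 0) : Function.Bijective (pair k) := by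
  constructor
  · rw [← LinearMap.ker_eq_bot, LinearMap.ker_eq_bot']
    intro x hx
    exact Prod.ext (pair_eq_zero hx).1 (pair_eq_zero hx).2
  · intro D
    obtain ⟨c, d, rfl⟩ := exists_pair h2 D
    exact ⟨(c, d), rfl⟩

theorem pair_mem_IDer (x : k × k) : pair k x ∈ (P k).IDer ↔ x.2 = 0 := by
  constructor
  · rintro ⟨l, hl⟩
    obtain ⟨a, rfl⟩ := Submodule.mem_span_singleton.mp (mem_low l)
    -- The inner derivation of `a • one` is -a E; bringing it to the other side gives a vanishing
    -- combination of E and B.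
    refine (pair_eq_zero (c := x.1 + a) (d := x.2) ?_).2
    refine Subtype.ext (funext fun n => LinearMap.ext fun θ => ?_)
    rw [pair_apply]
    have := hl n θ
    rw [inner_smul_one, pair_def, pair_apply] at this
    refine Eq.trans ?_ (add_eq_zero_iff_eq_neg.mpr (this.trans (by rw [neg_smul]) :
      _ = -(a • ((n : k) - 1) • θ)))
    module
  · intro h
    rw [pair_def, h, zero_smul, add_zero]
    exact smul_arityDer_mem_IDer _ _

/-- E is scalar in each arity, hence commutes with every derivation, and the only other basis
element B commutes with itself. -/
theorem der_isLieAbelian (h2 : (2 : k) ≠ 0) : IsLieAbelian (P k).Der := by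
  have har (D : (P k).Der) : ⁅(P k).arityDer, D⁆ = 0 := by
    refine Subtype.ext (funext fun n => LinearMap.ext fun θ => ?_)
    change ((n : k) - 1) • D.1 n θ - D.1 n (((n : k) - 1) • θ) = 0
    rw [map_smul, sub_self]
  refine ⟨fun D E => ?_⟩
  obtain ⟨a, b, rfl⟩ := exists_pair h2 D
  obtain ⟨c, d, rfl⟩ := exists_pair h2 E
  have hra : ⁅bracketDer k, (P k).arityDer⁆ = 0 := by
    rw [← lie_skew, har, neg_zero]
  simp only [add_lie, lie_add, smul_lie, lie_smul, har, hra, lie_self, smul_zero, add_zero]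

theorem der_and_H1 (h2 : (2 : k) ≠ 0) :
    Nonempty ((P k).Der ≃ₗ[k] k × k) ∧ IsLieAbelian (P k).Der ∧ Nonempty ((P k).H1 ≃ₗ[k] k) := by
  let e := LinearEquiv.ofBijective (pair k) (pair_bijective h2)
  refine ⟨⟨e.symm⟩, der_isLieAbelian h2, ⟨?_⟩⟩
  -- The coefficient of B; its kernel is the space of inner derivations, so it identifies the
  -- cohomology with k.
  let f : (P k).Der →ₗ[k] k := LinearMap.snd k k k ∘ₗ e.symm.toLinearMap
  have hf : Function.Surjective f := fun d => ⟨e (0, d), by simp [f]⟩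
  have hker : (P k).IDer = LinearMap.ker f := by
    ext D
    obtain ⟨x, rfl⟩ := e.surjective D
    have : f (e x) = x.2 := by simp [f]
    rw [LinearMap.mem_ker, this]
    exact pair_mem_IDer x
  exact (Submodule.quotEquivOfEq _ _ hker).trans (f.quotKerEquivOfSurjective hf)

end PoisOperad

theorem theorem0p3 (k : Type u) [Field k] :
    (Nonempty ((As k).Der ≃ₗ[k] k) ∧ Subsingleton (As k).H1) ∧
    (Nonempty ((Com k).Der ≃ₗ[k] k) ∧ Subsingleton (Com k).H1) ∧
    (Nonempty ((LieOperad k).Der ≃ₗ[k] k) ∧ Subsingleton (LieOperad k).H1) ∧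
    ((2 : k) ≠ 0 →
      Nonempty ((PoisOperad k).Der ≃ₗ[k] k × k) ∧ IsLieAbelian (PoisOperad k).Der ∧
      Nonempty ((PoisOperad k).H1 ≃ₗ[k] k)) :=
  ⟨(As k).der_equiv_and_H1 ⟨Finsupp.single 1 1, fun h => one_ne_zero (Finsupp.single_eq_zero.mp h)⟩
      (as_der k),
    (Com k).der_equiv_and_H1 ⟨(1 : k), one_ne_zero (α := k)⟩ (com_der k),
    Operad.der_equiv_and_H1 _ ⟨_, LieOperad.br_ne_zero⟩ LieOperad.exists_smul_arityDer,
    PoisOperad.der_and_H1⟩
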